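/- Let $n\ge 1$, $0\le k\le n$, $[n]=\{1,\dots,n\}$. Definitions. Let $\lambda$ be a Young diagram inside a $k\times(n-k)$ box. Label its southeast border steps $1,\dots,n$, from the northeast to the southwest corner of the box; a row (column) is labelled by the vertical (horizontal) step at its end, and squares are given by their (row, column) labels. A Le diagram of type $(k,n)$ is such a $\lambda$ with a filling of its squares by $+$ and $0$ such that whenever $a<c$, $b<d$, the squares $(a,b)$ and $(c,d)$ contain $+$, and $(c,b)$ is a square of $\lambda$, then $(c,b)$ contains $+$. A Grassmann necklace of type $(k,n)$ is a sequence $\mathcal I=(I_1,\dots,I_n)$ of $k$-element subsets of $[n]$ such that (with $I_{n+1}=I_1$) for every $i\in[n]$: if $i\in I_i$, then $I_{i+1}=(I_i\setminus\{i\})\cup\{j\}$ for some $j\in[n]$ (possibly $j=i$); if $i\notin I_i$, then $I_{i+1}=I_i$. Oh's map $\mathcal I$. A square $(a,b)$ is weakly (strictly) northwest of $(c,d)$ if $a\le c$, $b\ge d$ ($a<c$, $b>d$). For a Le diagram $L$, let $I_1$ be the set of row labels. For $2\le i\le n$ let $\overline{i}$ be the square whose southeast corner is the point between border steps $i-1$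 and $i$, if there is one. Start in the nearest $+$ square weakly northwest of $\overline{i}$ and repeatedly step to the nearest $+$ square strictly northwest of the current one, as long as possible, where the nearest such $+$ square is the one which all the other such $+$ squares are weakly northwest of (if there is no square $\overline{i}$, or no $+$ square weakly northwest of it, the path is empty). Then $I_i=(I_1\setminus\{\text{rows on this path}\})\cup\{\text{columns on this path}\}$, and $\mathcal I(L)=(I_1,\dots,I_n)$. The reverse algorithm $\mathcal L$. Given a Grassmann necklace $\mathcal I$ of type $(k,n)$, draw in the $k\times(n-k)$ box the Young diagram whose rows are labelled by $I_1$. For each $2\le i\le n$ write $I_1\setminus I_i=\{a_1>\dots>a_r\}$, $I_i\setminus I_1=\{b_1<\dots<b_r\}$, and place a $+$ in the squares $(a_1,b_1),\dots,(a_r,b_r)$. Finally place a $0$ in all remaining squares. The result is $\mathcal L(\mathcal I)$. Theorem. The algorithm $\mathcal L$ uniquely constructs the Le diagram associated to a Grassmann necklace: (1) for every Le diagram $L$ of type $(k,n)$, $\mathcal I(L)$ is a Grassmann necklace of type $(k,n)$ and $\mathcal L(\mathcal I(L))=L$; (2) for every Grassmann necklace $\mathcal I$ of type $(k,n)$, $\mathcal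 L(\mathcal I)$ is well defined (all the pairs $(a_j,b_j)$ are squares of the diagram drawn) and is a Le diagram of type $(k,n)$; it satisfies $\mathcal I(\mathcal L(\mathcal I))=\mathcal I$, and it is the only Le diagram $L$ of type $(k,n)$ with $\mathcal I(L)=\mathcal I$. -/

import Mathlib

/-- A Young diagram (English notation, rows and columns counted from `0`) together with the set of
its squares that contain a `+`; all other squares contain a `0`.  The squares in `plus` are given by
their row and column labels, as in `squares` below. -/
@[ext]
structure Diagram where
  shape : YoungDiagram
  plus : Finset (ℕ × ℕ)

namespace Diagram

/-- The Young diagram fits inside a box with `k` rows and `n - k` columns. -/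
def Fits (k n : ℕ) (μ : YoungDiagram) : Prop :=
  ∀ c ∈ μ.cells, c.1 < k ∧ c.2 < n - k

/-- The southeast border of a Young diagram in the `k × (n - k)` box is a lattice path with `n` unit
steps from the northeast to the southwest corner of the box, numbered `1, …, n`.  The vertical
step at the end of row `r` comes after the `n - k - rowLen r` horizontal steps to its right and the
`r` vertical steps above it; its number is the label of row `r`. -/
def rowLabel (k n : ℕ) (μ : YoungDiagram) (r : ℕ) : ℕ :=
  (n - k - μ.rowLen r) + r + 1

/-- The horizontal step at the bottom of column `c` comes after the `n - k - c - 1` horizontal steps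
to its right and the `colLen c` vertical steps above it; its number is the label of column `c`. -/
def colLabel (k n : ℕ) (μ : YoungDiagram) (c : ℕ) : ℕ :=
  (n - k - c - 1) + μ.colLen c + 1

/-- The labels of all `k` rows of the box (including rows without squares). -/
def rowLabels (k n : ℕ) (μ : YoungDiagram) : Finset ℕ :=
  (Finset.range k).image (rowLabel k n μ)

/-- The label coordinates of a square. -/
def label (k n : ℕ) (μ : YoungDiagram) (c : ℕ × ℕ) : ℕ × ℕ :=
  (rowLabel k n μ c.1, colLabel k n μ c.2)

/-- The squares of a Young diagram, in label coordinates. -/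
def squares (k n : ℕ) (μ : YoungDiagram) : Finset (ℕ × ℕ) :=
  μ.cells.image (label k n μ)

/-- Le diagrams of type `(k, n)`. -/
structure IsLe (k n : ℕ) (D : Diagram) : Prop where
  fits : Fits k n D.shape
  plus_subset : D.plus ⊆ squares k n D.shape
  le_rule : ∀ a b c d : ℕ, a < c → b < d → (a, b) ∈ D.plus → (c, d) ∈ D.plus →
    (c, b) ∈ squares k n D.shape → (c, b) ∈ D.plus

/-- `s` is strictly northwest of `t` (label coordinates). -/
def StrictlyNW (s t : ℕ × ℕ) : Prop := s.1 < t.1 ∧ t.2 < s.2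

/-- `s` is weakly northwest of `t` (label coordinates). -/
def WeaklyNW (s t : ℕ × ℕ) : Prop := s.1 ≤ t.1 ∧ t.2 ≤ s.2

/-- Among the `+` squares `t` with `P t`, the square `s` is the nearest one for a viewer in the
southeast: every other such square is weakly northwest of `s`. -/
def IsNearestPlus (D : Diagram) (P : ℕ × ℕ → Prop) (s : ℕ × ℕ) : Prop :=
  (s ∈ D.plus ∧ P s) ∧ ∀ t ∈ D.plus, P t → WeaklyNW t s

/-- The squares along the southeast boundary of `μ` are the squares with no square diagonally
southeast of them.  They are numbered along the boundary from the northeast corner of the box on,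
where the square in the northeast corner of the box, if it belongs to `μ`, gets number `2`: the
boundary square `c` with number `i` is the square whose southeast corner is the point between the
border steps `i - 1` and `i`.  If that point lies on the top or left side of the box, there is no
such square. -/
def IsBoundarySquare (k n : ℕ) (μ : YoungDiagram) (i : ℕ) (c : ℕ × ℕ) : Prop :=
  c ∈ μ.cells ∧ (c.1 + 1, c.2 + 1) ∉ μ.cells ∧ i = (n - k - c.2 - 1) + c.1 + 2

/-- The squares (in label coordinates) of the path from the `i`-th boundary square: start in the
nearest `+` square weakly northwest of it, then keep stepping to the nearest `+` square strictly
northwest of the current position, as long as possible. -/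
inductive InPath (k n : ℕ) (D : Diagram) (i : ℕ) : ℕ × ℕ → Prop
  | start (c s : ℕ × ℕ) : IsBoundarySquare k n D.shape i c →
      IsNearestPlus D (fun t => WeaklyNW t (label k n D.shape c)) s → InPath k n D i s
  | step (s t : ℕ × ℕ) : InPath k n D i s →
      IsNearestPlus D (fun u => StrictlyNW u s) t → InPath k n D i t

open Classical in
/-- Oh's algorithm: the `i`-th term (`1 ≤ i ≤ n`) of the sequence `𝓘(D)`.  The first term is the set
of row labels; to get the `i`-th one, remove the rows and add the columns involved in the path from
the `i`-th boundary square. -/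
noncomputable def ohNecklace (k n : ℕ) (D : Diagram) (i : ℕ) : Finset ℕ :=
  if i = 1 then rowLabels k n D.shape
  else (rowLabels k n D.shape \ (Finset.Icc 1 n).filter fun a => ∃ b, InPath k n D i (a, b)) ∪
    (Finset.Icc 1 n).filter fun b => ∃ a, InPath k n D i (a, b)

/-- Grassmann necklaces of type `(k, n)`: sequences `I 1, …, I n` (other values of `I` play no role)
of `k`-element subsets of `[n]` with the necklace rule, where the term after `I n` is `I 1`. -/
def IsGrassmannNecklace (k n : ℕ) (I : ℕ → Finset ℕ) : Prop :=
  ∀ i ∈ Finset.Icc 1 n, I i ⊆ Finset.Icc 1 n ∧ (I i).card = k ∧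
    (i ∈ I i → ∃ j ∈ Finset.Icc 1 n,
      I (if i = n then 1 else i + 1) = insert j ((I i).erase i)) ∧
    (i ∉ I i → I (if i = n then 1 else i + 1) = I i)

/-- The row lengths, from top to bottom, of the Young diagram in the box of size
`#S × (n - #S)` whose rows are labelled by `S`: the length of the row labelled `a` is the
number of horizontal border steps that come after step `a`. -/
def rowLensOf (n : ℕ) (S : Finset ℕ) : List ℕ :=
  (S.sort (· ≤ ·)).map fun a => ((Finset.Icc 1 n \ S).filter fun b => a < b).card

theorem rowLensOf_sorted (n : ℕ) (S : Finset ℕ) : (rowLensOf n S).SortedGE := by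
  have h : (S.sort (· ≤ ·)).Pairwise (· ≤ ·) := Finset.pairwise_sort S (· ≤ ·)
  refine List.Pairwise.sortedGE ?_
  refine List.Pairwise.map _ (fun a b hab => ?_) h
  refine Finset.card_le_card fun x hx => ?_
  simp only [Finset.mem_filter] at hx ⊢
  exact ⟨hx.1, lt_of_le_of_lt hab hx.2⟩

/-- The Young diagram whose rows are labelled by `S ⊆ [n]`. -/
def shapeOf (n : ℕ) (S : Finset ℕ) : YoungDiagram :=
  YoungDiagram.ofRowLens (rowLensOf n S) (rowLensOf_sorted n S)

/-- The squares `(a₁, b₁), …, (a_r, b_r)` where `S \ T = {a₁ > … > a_r}` and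
`T \ S = {b₁ < … < b_r}`. -/
def pairedSquares (S T : Finset ℕ) : Finset (ℕ × ℕ) :=
  (((S \ T).sort (· ≥ ·)).zip ((T \ S).sort (· ≤ ·))).toFinset

/-- The reverse algorithm `𝓛`: draw the Young diagram whose rows are labelled by `I 1`, and place a
`+` exactly in the squares obtained by pairing `I 1 \ I i` with `I i \ I 1`, for `2 ≤ i ≤ n`. -/
def ofNecklace (n : ℕ) (I : ℕ → Finset ℕ) : Diagram where
  shape := shapeOf n (I 1)
  plus := (Finset.Icc 2 n).biUnion fun i => pairedSquares (I 1) (I i)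

end Diagram

namespace Diagram

/-! ### Greedy paths -/

/-! In label coordinates a diagram is a set `S` of row labels and a set `P` of pairs `(a, b)` with
`a ∈ S`, `b ∉ S`, `a < b`, and the squares weakly northwest of the `k`-th boundary square are those
with `a < k ≤ b`. The Le rule makes nearest `+` squares exist, so paths are well defined
(`IsLeSet.exists_isPath`). Rows strictly decrease and columns strictly increase along a path, so
sorting `S \ I k` and `I k \ S` in opposite directions and pairing them recovers the path
(`IsLeSet.pairedSquares_neck`).

All else is an induction that removes corners. If `i ∈ S` and `i + 1 ∉ S`, then `(i, i + 1)` is a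
corner; removing it exchanges the labels `i` and `i + 1`. Every term of the sequence is merely
relabelled, except term `i + 1`. If the corner holds `+`, that term is unchanged. If it holds `0`,
the Le rule forces row `i` or column `i + 1` to be free of `+`, and term `i + 1` coincides with a
neighbouring term both before and after. These are the alternatives of `CornerRel`, proved in
`HasCorner.cornerRel`.

`CornerRel` is symmetric and preserves the necklace rule, so Oh's sequence is a necklace
(`IsLeSet.necklaceStep`). The same induction shows that each `+` lies on some path
(`IsLeSet.exists_mem_path`), hence the reverse algorithm recovers the diagram. Conversely, a
necklace at a corner shows one of the same three patterns, which tells how to refill the corner;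
thus every necklace comes from a Le diagram (`exists_neck_eq`). Everything in the second half of the
theorem then follows formally from this surjectivity and the left inverse. -/

/-- `IsNearestPlus` for a bare set of squares. -/
def IsNearest (P : Finset (ℕ × ℕ)) (Q : ℕ × ℕ → Prop) (s : ℕ × ℕ) : Prop :=
  (s ∈ P ∧ Q s) ∧ ∀ t ∈ P, Q t → WeaklyNW t s

/-- The list of squares on the greedy path in `P` that starts in the region `Q`. -/
inductive IsPath (P : Finset (ℕ × ℕ)) : (ℕ × ℕ → Prop) → List (ℕ × ℕ) → Prop
  | nil (Q : ℕ × ℕ → Prop) : (∀ t ∈ P, ¬ Q t) → IsPath P Q []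
  | cons (Q : ℕ × ℕ → Prop) (s : ℕ × ℕ) (l : List (ℕ × ℕ)) : IsNearest P Q s →
      IsPath P (fun u => StrictlyNW u s) l → IsPath P Q (s :: l)

variable {n i k : ℕ} {S : Finset ℕ} {P P' : Finset (ℕ × ℕ)} {Q Q' : ℕ × ℕ → Prop}
  {s t : ℕ × ℕ} {l l' : List (ℕ × ℕ)}

theorem IsNearest.unique (hs : IsNearest P Q s) (ht : IsNearest P Q t) : s = t := by
  obtain ⟨⟨h1, h2⟩, h3⟩ := hs
  obtain ⟨⟨h4, h5⟩, h6⟩ := ht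
  have h7 := h3 t h4 h5
  have h8 := h6 s h1 h2
  unfold WeaklyNW at h7 h8
  ext <;> omega

theorem IsPath.unique (h : IsPath P Q l) (h' : IsPath P Q l') : l = l' := by
  induction h generalizing l' with
  | nil Q h =>
    cases h' with
    | nil => rfl
    | cons _ s l hs _ => exact absurd hs.1.2 (h s hs.1.1)
  | cons Q s l hs _ ih =>
    cases h' with
    | nil _ h => exact absurd hs.1.2 (h s hs.1.1)
    | cons _ s' l' hs' hl' =>
      obtain rfl := hs.unique hs'
      rw [ih hl']

/-- The greedy path depends only on the two northwest relations among `+` squares and on the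
starting region, so it is transported by any relabelling that respects these. -/
theorem IsPath.map {f : ℕ × ℕ → ℕ × ℕ} (h : IsPath P Q l) (hP : P' = P.image f)
    (hs : ∀ s ∈ P, ∀ t ∈ P, StrictlyNW (f s) (f t) ↔ StrictlyNW s t)
    (hw : ∀ s ∈ P, ∀ t ∈ P, WeaklyNW (f s) (f t) ↔ WeaklyNW s t)
    (hQ : ∀ t ∈ P, Q' (f t) ↔ Q t) : IsPath P' Q' (l.map f) := by
  subst hP
  induction h generalizing Q' with
  | nil Q h =>
    refine .nil _ fun t ht => ?_
    obtain ⟨u, hu, rfl⟩ := Finset.mem_image.1 ht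
    rw [hQ u hu]
    exact h u hu
  | cons Q s l hn _ ih =>
    refine .cons _ _ _ ⟨⟨Finset.mem_image_of_mem f hn.1.1, (hQ s hn.1.1).2 hn.1.2⟩, ?_⟩
      (ih fun t ht => hs t ht s hn.1.1)
    intro t ht hQt
    obtain ⟨u, hu, rfl⟩ := Finset.mem_image.1 ht
    exact (hw u hu s hn.1.1).2 (hn.2 u hu ((hQ u hu).1 hQt))

theorem IsPath.congr (h : IsPath P Q l) (hQ : ∀ t ∈ P, Q' t ↔ Q t) : IsPath P Q' l := by
  simpa using h.map (f := id) (by simp) (by simp) (by simp) hQ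

theorem IsPath.erase {c : ℕ × ℕ} (h : IsPath P Q l) (hc : ¬ Q c)
    (hP : ∀ s ∈ P, ¬ StrictlyNW c s) : IsPath (P.erase c) Q l := by
  induction h with
  | nil Q h => exact .nil _ fun t ht => h t (Finset.mem_of_mem_erase ht)
  | cons Q s l hn _ ih =>
    refine .cons _ _ _ ⟨⟨Finset.mem_erase.2 ⟨?_, hn.1.1⟩, hn.1.2⟩,
      fun t ht => hn.2 t (Finset.mem_of_mem_erase ht)⟩ (ih (hP s hn.1.1))
    rintro rfl
    exact hc hn.1.2

theorem IsPath.mem (h : IsPath P Q l) : ∀ s ∈ l, s ∈ P := by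
  induction h with
  | nil => simp
  | cons Q s l hn _ ih => simpa using ⟨hn.1.1, fun a b h => ih (a, b) h⟩

theorem IsPath.region (h : IsPath P Q l) (hQ : ∀ s t, Q s → StrictlyNW t s → Q t) :
    ∀ s ∈ l, Q s := by
  induction h with
  | nil => simp
  | cons Q s l hn _ ih =>
    intro t ht
    rcases List.mem_cons.1 ht with rfl | ht
    · exact hn.1.2
    · refine hQ s t hn.1.2 (ih (fun u v hu hv => ?_) t ht)
      exact ⟨hv.1.trans hu.1, hu.2.trans hv.2⟩

theorem IsPath.pairwise (h : IsPath P Q l) : l.Pairwise fun s t => StrictlyNW t s := by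
  induction h with
  | nil => simp
  | cons Q s l hn hl ih =>
    exact List.pairwise_cons.2 ⟨hl.region fun u v hu hv => ⟨hv.1.trans hu.1, hu.2.trans hv.2⟩, ih⟩

/-! ### Le diagrams in label coordinates -/

/-- The label version of Le diagrams: `S` is the set of row labels, `P` the set of `+` squares. -/
structure IsLeSet (n : ℕ) (S : Finset ℕ) (P : Finset (ℕ × ℕ)) : Prop where
  subset : S ⊆ Finset.Icc 1 n
  mem : ∀ t ∈ P, t.1 ∈ S ∧ t.2 ∈ Finset.Icc 1 n ∧ t.2 ∉ S ∧ t.1 < t.2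
  le_rule : ∀ a b c d : ℕ, a < c → b < d → c < b → (a, b) ∈ P → (c, d) ∈ P → (c, b) ∈ P

/-- The squares weakly northwest of the `k`-th boundary square. -/
def Around (k : ℕ) (t : ℕ × ℕ) : Prop := t.1 < k ∧ k ≤ t.2

theorem IsLeSet.exists_nearest (hP : IsLeSet n S P) {x y : ℕ} (hxy : x ≤ y)
    (h : ∃ t ∈ P, t.1 < x ∧ y ≤ t.2) : ∃ s, IsNearest P (fun t => t.1 < x ∧ y ≤ t.2) s := by
  have hne : (P.filter fun t => t.1 < x ∧ y ≤ t.2).Nonempty := by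
    obtain ⟨t, ht⟩ := h
    exact ⟨t, by simpa using ht⟩
  obtain ⟨u, hu, hu'⟩ := Finset.exists_max_image _ Prod.fst hne
  obtain ⟨v, hv, hv'⟩ := Finset.exists_min_image _ Prod.snd hne
  simp only [Finset.mem_filter] at hu hv hu' hv'
  have h1 := hu' v hv
  have h2 := hv' u hu
  -- The largest row and the smallest column may come from different squares; the Le rule puts a `+`
  -- where they cross. The crossing is a square because `u.1 < x ≤ y ≤ v.2`.
  have key : (u.1, v.2) ∈ P := by
    rcases h1.eq_or_lt with h1 | h1
    · rw [← h1]; exact hv.1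
    rcases h2.eq_or_lt with h2 | h2
    · rw [h2]; exact hu.1
    exact hP.le_rule v.1 v.2 u.1 u.2 h1 h2 (by omega) hv.1 hu.1
  exact ⟨(u.1, v.2), ⟨key, hu.2.1, hv.2.2⟩, fun t ht hQ => ⟨hu' t ⟨ht, hQ⟩, hv' t ⟨ht, hQ⟩⟩⟩

theorem IsLeSet.exists_isPath (hP : IsLeSet n S P) (x : ℕ) :
    ∀ y, x ≤ y → ∃ l, IsPath P (fun t => t.1 < x ∧ y ≤ t.2) l := by
  induction x using Nat.strong_induction_on with
  | _ x ih =>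
    intro y hxy
    by_cases h : ∃ t ∈ P, t.1 < x ∧ y ≤ t.2
    · obtain ⟨s, hs⟩ := hP.exists_nearest hxy h
      -- Strictly northwest of `s` is again a region of this form, with bounds `s.1` and `s.2 + 1`.
      obtain ⟨l, hl⟩ := ih s.1 hs.1.2.1 (s.2 + 1) (by have := hs.1.2; omega)
      exact ⟨s :: l, .cons _ _ _ hs hl⟩
    · exact ⟨[], .nil _ fun t ht hQ => h ⟨t, ht, hQ⟩⟩

open Classical in
/-- The path from the `k`-th boundary square. -/
noncomputable def path (P : Finset (ℕ × ℕ)) (k : ℕ) : List (ℕ × ℕ) :=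
  if h : ∃ l, IsPath P (Around k) l then h.choose else []

theorem IsLeSet.isPath (hP : IsLeSet n S P) (k : ℕ) : IsPath P (Around k) (path P k) := by
  have h : ∃ l, IsPath P (Around k) l := hP.exists_isPath k k le_rfl
  rw [path, dif_pos h]
  exact h.choose_spec

theorem IsPath.path_eq (h : IsPath P (Around k) l) : path P k = l := by
  have h' : ∃ l, IsPath P (Around k) l := ⟨l, h⟩
  rw [path, dif_pos h']
  exact h'.choose_spec.unique h

/-! ### Sets read off from paths -/

/-- Exchange the rows of the squares in `l` for their columns. -/
def exch (S : Finset ℕ) (l : List (ℕ × ℕ)) : Finset ℕ :=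
  (S \ (l.map Prod.fst).toFinset) ∪ (l.map Prod.snd).toFinset

theorem mem_exch {x : ℕ} :
    x ∈ exch S l ↔ (x ∈ S ∧ ∀ t ∈ l, t.1 ≠ x) ∨ ∃ t ∈ l, t.2 = x := by
  simp only [exch, Finset.mem_union, Finset.mem_sdiff, List.mem_toFinset, List.mem_map]
  grind

/-- The sequence of sets read off from the paths. -/
noncomputable def neck (S : Finset ℕ) (P : Finset (ℕ × ℕ)) (k : ℕ) : Finset ℕ :=
  exch S (path P k)

theorem IsLeSet.sdiff_neck (hP : IsLeSet n S P) (k : ℕ) :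
    S \ neck S P k = ((path P k).map Prod.fst).toFinset := by
  have h := fun t ht => hP.mem t ((hP.isPath k).mem t ht)
  ext x
  simp only [Finset.mem_sdiff, neck, mem_exch, List.mem_toFinset, List.mem_map]
  constructor
  · rintro ⟨hx, h'⟩
    by_contra! h2
    exact h' (.inl ⟨hx, h2⟩)
  · rintro ⟨t, ht, rfl⟩
    refine ⟨(h t ht).1, ?_⟩
    rintro (⟨_, h2⟩ | ⟨u, hu, h2⟩)
    · exact h2 t ht rfl
    · exact (h u hu).2.2.1 (h2 ▸ (h t ht).1)

theorem IsLeSet.neck_sdiff (hP : IsLeSet n S P) (k : ℕ) :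
    neck S P k \ S = ((path P k).map Prod.snd).toFinset := by
  have h := fun t ht => hP.mem t ((hP.isPath k).mem t ht)
  ext x
  simp only [Finset.mem_sdiff, neck, mem_exch, List.mem_toFinset, List.mem_map]
  constructor
  · rintro ⟨⟨h1, _⟩ | h1, h2⟩
    · exact absurd h1 h2
    · exact h1
  · rintro ⟨t, ht, rfl⟩
    exact ⟨.inr ⟨t, ht, rfl⟩, (h t ht).2.2.1⟩

/-- The path lists its rows in decreasing and its columns in increasing order, so the two sorted
lists zip back to the path itself. -/
theorem IsLeSet.pairedSquares_neck (hP : IsLeSet n S P) (k : ℕ) :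
    pairedSquares S (neck S P k) = (path P k).toFinset := by
  have hp := (hP.isPath k).pairwise
  have h1 : ((path P k).map Prod.fst).Pairwise (· > ·) :=
    List.pairwise_map.2 (hp.imp fun h => h.1)
  have h2 : ((path P k).map Prod.snd).Pairwise (· < ·) :=
    List.pairwise_map.2 (hp.imp fun h => h.2)
  rw [pairedSquares, hP.sdiff_neck, hP.neck_sdiff,
    (List.toFinset_sort (· ≥ ·) (h1.imp fun h => ne_of_gt h)).2 (h1.imp fun h => le_of_lt h),
    (List.toFinset_sort (· ≤ ·) (h2.imp fun h => ne_of_lt h)).2 (h2.imp fun h => le_of_lt h)]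
  congr 1
  exact List.zip_of_prod rfl rfl |>.symm

theorem IsLeSet.card_neck (hP : IsLeSet n S P) (k : ℕ) : (neck S P k).card = S.card := by
  have hp := (hP.isPath k).pairwise
  have h1 : ((path P k).map Prod.fst).Nodup :=
    List.pairwise_map.2 (hp.imp fun h => ne_of_gt h.1)
  have h2 : ((path P k).map Prod.snd).Nodup :=
    List.pairwise_map.2 (hp.imp fun h => ne_of_lt h.2)
  have h3 := Finset.card_sdiff_add_card_inter S (neck S P k)
  have h4 := Finset.card_sdiff_add_card_inter (neck S P k) S
  rw [hP.sdiff_neck, List.toFinset_card_of_nodup h1] at h3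
  rw [hP.neck_sdiff, List.toFinset_card_of_nodup h2, Finset.inter_comm] at h4
  simp only [List.length_map] at h3 h4
  omega

theorem IsLeSet.neck_subset (hP : IsLeSet n S P) (k : ℕ) : neck S P k ⊆ Finset.Icc 1 n := by
  intro x hx
  rcases mem_exch.1 hx with ⟨h, _⟩ | ⟨t, ht, rfl⟩
  · exact hP.subset h
  · exact (hP.mem t ((hP.isPath k).mem t ht)).2.1

theorem IsLeSet.path_eq_nil (hP : IsLeSet n S P) (hk : k ≤ 1 ∨ n < k) : path P k = [] := by
  refine (IsPath.nil _ fun t ht h => ?_).path_eq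
  obtain ⟨h1, h2, h3, h4⟩ := hP.mem t ht
  have h5 := hP.subset h1
  simp only [Finset.mem_Icc] at h2 h5
  unfold Around at h
  omega

theorem IsLeSet.neck_eq_self (hP : IsLeSet n S P) (hk : k ≤ 1 ∨ n < k) : neck S P k = S := by
  simp [neck, exch, hP.path_eq_nil hk]

/-! ### Necklace steps -/

/-- One step of a Grassmann necklace. -/
def NecklaceStep (n x : ℕ) (J K : Finset ℕ) : Prop :=
  (x ∈ J → ∃ j ∈ Finset.Icc 1 n, K = insert j (J.erase x)) ∧ (x ∉ J → K = J)

theorem NecklaceStep.refl {x : ℕ} (hx : x ∈ Finset.Icc 1 n) (J : Finset ℕ) :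
    NecklaceStep n x J J :=
  ⟨fun h => ⟨x, hx, (Finset.insert_erase h).symm⟩, fun _ => rfl⟩

theorem NecklaceStep.mem {x a : ℕ} {J K : Finset ℕ} (h : NecklaceStep n x J K) (ha : a ∈ J)
    (hx : a ≠ x) : a ∈ K := by
  by_cases hJ : x ∈ J
  · obtain ⟨j, _, rfl⟩ := h.1 hJ
    simp [ha, hx]
  · rwa [h.2 hJ]

theorem NecklaceStep.image {x : ℕ} {J K : Finset ℕ} (σ : Equiv.Perm ℕ)
    (hσ : ∀ j ∈ Finset.Icc 1 n, σ j ∈ Finset.Icc 1 n) (h : NecklaceStep n x J K) :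
    NecklaceStep n (σ x) (J.image σ) (K.image σ) := by
  refine ⟨fun hx => ?_, fun hx => ?_⟩
  · obtain ⟨j, hj, rfl⟩ := h.1 (by simpa using hx)
    exact ⟨σ j, hσ j hj, by rw [Finset.image_insert, Finset.image_erase σ.injective]⟩
  · rw [h.2 (by simpa using hx)]

theorem mem_image_swap {x : ℕ} {J : Finset ℕ} :
    x ∈ J.image (Equiv.swap i (i + 1)) ↔ Equiv.swap i (i + 1) x ∈ J := by
  constructor
  · intro h
    obtain ⟨y, hy, rfl⟩ := Finset.mem_image.1 h
    simpa using hy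
  · intro h
    exact Finset.mem_image.2 ⟨_, h, by simp⟩

theorem image_swap_image_swap (J : Finset ℕ) :
    (J.image (Equiv.swap i (i + 1))).image (Equiv.swap i (i + 1)) = J := by
  ext x
  simp

theorem swap_mem_Icc (hi : 1 ≤ i) (hin : i + 1 ≤ n) (j : ℕ) (hj : j ∈ Finset.Icc 1 n) :
    Equiv.swap i (i + 1) j ∈ Finset.Icc 1 n := by
  simp only [Finset.mem_Icc, Equiv.swap_apply_def] at *
  split_ifs <;> omega

/-- The relation between the sequences of two diagrams, one of which arises from the other by
removing the corner square between the border steps `i` and `i + 1`. -/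
def CornerRel (i : ℕ) (I I' : ℕ → Finset ℕ) : Prop :=
  (∀ k, k ≠ i + 1 → I' k = (I k).image (Equiv.swap i (i + 1))) ∧
    ((I' (i + 1) = I (i + 1) ∧ i ∉ I (i + 1) ∧ i + 1 ∈ I (i + 1)) ∨
      (I (i + 1) = I i ∧ I' (i + 1) = I' (i + 2)) ∨
      (I (i + 1) = I (i + 2) ∧ I' (i + 1) = I' i))

theorem CornerRel.symm {I I' : ℕ → Finset ℕ} (h : CornerRel i I I') : CornerRel i I' I := by
  refine ⟨fun k hk => by rw [h.1 k hk, image_swap_image_swap], ?_⟩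
  rcases h.2 with ⟨h1, h2, h3⟩ | ⟨h1, h2⟩ | ⟨h1, h2⟩
  · exact .inl ⟨h1.symm, by rwa [h1], by rwa [h1]⟩
  · exact .inr (.inr ⟨h2, h1⟩)
  · exact .inr (.inl ⟨h2, h1⟩)

/-- Only steps `i` and `i + 1` need care. In the last two alternatives of `CornerRel`, one of these
two steps is trivial for `I` and the other is trivial for `I'`, and the remaining ones are
relabellings of each other. -/
theorem CornerRel.necklaceStep {I I' : ℕ → Finset ℕ} (h : CornerRel i I I') (hi : 1 ≤ i)
    (hin : i + 1 ≤ n) (hI : ∀ k ∈ Finset.Icc 1 n, NecklaceStep n k (I k) (I (k + 1))) :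
    ∀ k ∈ Finset.Icc 1 n, NecklaceStep n k (I' k) (I' (k + 1)) := by
  have hsw := swap_mem_Icc hi hin
  have hi1 := hI i (Finset.mem_Icc.2 (by omega))
  have hi2 := hI (i + 1) (Finset.mem_Icc.2 (by omega))
  have him := hi1.image (Equiv.swap i (i + 1)) hsw
  have him2 := hi2.image (Equiv.swap i (i + 1)) hsw
  simp only [Equiv.swap_apply_left, Equiv.swap_apply_right] at him him2
  have e0 := h.1 i (by omega)
  have e2 := h.1 (i + 2) (by omega)
  intro k hk
  rcases eq_or_ne k i with rfl | hki
  · rcases h.2 with ⟨h1, h2, h3⟩ | ⟨h1, h2⟩ | ⟨h1, h2⟩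
    · rw [h1, e0]
      refine ⟨fun hk => ?_, fun hk => ?_⟩ <;>
        simp only [mem_image_swap, Equiv.swap_apply_left] at hk
      · by_cases hkI : k ∈ I k
        · obtain ⟨j, hj, hj'⟩ := hi1.1 hkI
          refine ⟨j, hj, ?_⟩
          rw [hj']
          congr 2
          ext x
          rw [mem_image_swap, Equiv.swap_apply_def]
          split_ifs with hx hx <;> simp_all
        · rw [hi1.2 hkI]
          -- Here `I k` contains `k + 1` but not `k`, so undoing the exchange means replacing `k` by
          -- `k + 1`.
          refine ⟨k + 1, by simp; omega, ?_⟩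
          ext x
          simp only [Finset.mem_insert, Finset.mem_erase, mem_image_swap, Equiv.swap_apply_def]
          split_ifs with hx hx <;> simp_all
      · have hkI : k ∈ I k := by
          by_contra hkI
          exact hk (hi1.2 hkI ▸ h3)
        obtain ⟨j, hj, hj'⟩ := hi1.1 hkI
        rw [hj'] at h3
        obtain rfl : k + 1 = j := by simpa [hk] using h3
        rw [hj']
        ext x
        simp only [Finset.mem_insert, Finset.mem_erase, mem_image_swap, Equiv.swap_apply_def]
        split_ifs with hx hx <;> simp_all
    · rw [h2, e0, e2, ← h1]
      exact him2
    · rw [h2]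
      exact .refl hk _
  rcases eq_or_ne k (i + 1) with rfl | hki1
  · rcases h.2 with ⟨h1, h2, h3⟩ | ⟨h1, h2⟩ | ⟨h1, h2⟩
    · rw [h1, e2]
      refine ⟨fun _ => ?_, fun h => absurd h3 h⟩
      obtain ⟨j, hj, hj'⟩ := hi2.1 h3
      refine ⟨_, hsw j hj, ?_⟩
      rw [hj', Finset.image_insert]
      congr 1
      ext x
      simp only [Finset.mem_erase, mem_image_swap, Equiv.swap_apply_def]
      split_ifs with hx hx <;> simp_all
    · rw [h2]
      exact .refl hk _
    · rw [h2, e0, e2, ← h1]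
      exact him
  · rw [h.1 k hki1, h.1 (k + 1) (by omega)]
    have := (hI k hk).image (Equiv.swap i (i + 1)) hsw
    rwa [Equiv.swap_apply_of_ne_of_ne hki hki1] at this

/-- An element `a` can leave only at step `a`, and the range from `k` to `m` avoids that step. -/
theorem mem_of_mem_of_necklaceStep {I : ℕ → Finset ℕ}
    (hI : ∀ k ∈ Finset.Icc 1 n, NecklaceStep n k (I k) (I (k + 1))) {a k m : ℕ} (hk : 1 ≤ k)
    (hkm : k ≤ m) (hm : m ≤ n + 1) (hak : a < k ∨ m ≤ a) (ha : a ∈ I k) : a ∈ I m := by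
  induction m, hkm using Nat.le_induction with
  | base => exact ha
  | succ m hkm ih =>
    exact (hI m (Finset.mem_Icc.2 (by omega))).mem (ih (by omega) (by omega)) (by omega)

/-! ### Removing a corner -/

/-- Exchange the labels `i` and `i + 1` in a square. -/
def swapLabels (i : ℕ) (t : ℕ × ℕ) : ℕ × ℕ :=
  (Equiv.swap i (i + 1) t.1, Equiv.swap i (i + 1) t.2)

theorem swapLabels_swapLabels (t : ℕ × ℕ) : swapLabels i (swapLabels i t) = t := by
  simp [swapLabels]

/-- Remove the corner square between the border steps `i` and `i + 1`. -/
def removeCorner (i : ℕ) (P : Finset (ℕ × ℕ)) : Finset (ℕ × ℕ) :=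
  (P.erase (i, i + 1)).image (swapLabels i)

theorem mem_image_swapLabels : t ∈ P.image (swapLabels i) ↔ swapLabels i t ∈ P := by
  constructor
  · intro h
    obtain ⟨y, hy, rfl⟩ := Finset.mem_image.1 h
    rwa [swapLabels_swapLabels]
  · intro h
    exact Finset.mem_image.2 ⟨_, h, swapLabels_swapLabels t⟩

theorem mem_removeCorner : t ∈ removeCorner i P ↔ swapLabels i t ∈ P.erase (i, i + 1) :=
  mem_image_swapLabels

theorem exch_map_swapLabels (S : Finset ℕ) (l : List (ℕ × ℕ)) :
    exch (S.image (Equiv.swap i (i + 1))) (l.map (swapLabels i)) =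
      (exch S l).image (Equiv.swap i (i + 1)) := by
  ext x
  rw [mem_exch, mem_image_swap, mem_image_swap, mem_exch]
  simp only [List.mem_map, swapLabels, forall_exists_index, and_imp, forall_apply_eq_imp_iff₂,
    exists_exists_and_eq_and, ne_eq, Equiv.swap_apply_eq_iff]

/-- The hypotheses for removing the corner between the border steps `i` and `i + 1`. -/
structure HasCorner (n i : ℕ) (S : Finset ℕ) (P : Finset (ℕ × ℕ)) : Prop where
  isLeSet : IsLeSet n S P
  le : i + 1 ≤ n
  mem : i ∈ S
  notMem : i + 1 ∉ S

namespace HasCorner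

theorem pos (h : HasCorner n i S P) : 1 ≤ i :=
  (Finset.mem_Icc.1 (h.isLeSet.subset h.mem)).1

theorem ne (h : HasCorner n i S P) (ht : t ∈ P) : t.1 ≠ i + 1 ∧ t.2 ≠ i := by
  obtain ⟨h1, _, h3, _⟩ := h.isLeSet.mem t ht
  exact ⟨fun he => h.notMem (he ▸ h1), fun he => h3 (he ▸ h.mem)⟩

/-- No row is labelled `i + 1`, so the exchange of two adjacent labels keeps the order of the rows;
likewise for columns, none of which is labelled `i`. -/
theorem swap_fst_lt_iff (h : HasCorner n i S P) (hs : s ∈ P) (ht : t ∈ P) :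
    Equiv.swap i (i + 1) s.1 < Equiv.swap i (i + 1) t.1 ↔ s.1 < t.1 := by
  have := h.ne hs
  have := h.ne ht
  simp only [Equiv.swap_apply_def]
  split_ifs <;> omega

theorem swap_snd_lt_iff (h : HasCorner n i S P) (hs : s ∈ P) (ht : t ∈ P) :
    Equiv.swap i (i + 1) s.2 < Equiv.swap i (i + 1) t.2 ↔ s.2 < t.2 := by
  have := h.ne hs
  have := h.ne ht
  simp only [Equiv.swap_apply_def]
  split_ifs <;> omega

theorem strictlyNW_iff (h : HasCorner n i S P) (hs : s ∈ P) (ht : t ∈ P) :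
    StrictlyNW (swapLabels i s) (swapLabels i t) ↔ StrictlyNW s t := by
  simp only [StrictlyNW, swapLabels, h.swap_fst_lt_iff hs ht, h.swap_snd_lt_iff ht hs]

theorem weaklyNW_iff (h : HasCorner n i S P) (hs : s ∈ P) (ht : t ∈ P) :
    WeaklyNW (swapLabels i s) (swapLabels i t) ↔ WeaklyNW s t := by
  simp only [WeaklyNW, swapLabels]
  rw [← not_lt, ← not_lt, h.swap_fst_lt_iff ht hs, h.swap_snd_lt_iff hs ht, not_lt, not_lt]

theorem isLeSet_removeCorner (h : HasCorner n i S P) :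
    IsLeSet n (S.image (Equiv.swap i (i + 1))) (removeCorner i P) := by
  have hsw := swap_mem_Icc h.pos h.le
  refine ⟨fun x hx => ?_, fun t ht => ?_, fun a b c d hac hbd hcb h1 h2 => ?_⟩
  · have := hsw _ (h.isLeSet.subset (mem_image_swap.1 hx))
    simpa using this
  · have ht2 := swapLabels_swapLabels (i := i) t
    obtain ⟨hne, ht⟩ := Finset.mem_erase.1 (mem_removeCorner.1 ht)
    have h5 := h.ne ht
    obtain ⟨h1, h2, h3, h4⟩ := h.isLeSet.mem _ ht
    refine ⟨mem_image_swap.2 h1, congrArg Prod.snd ht2 ▸ hsw _ h2, fun h' => h3 (mem_image_swap.1 h'), ?_⟩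
    simp only [swapLabels, Equiv.swap_apply_def, ne_eq, Prod.mk.injEq] at h4 hne h5
    split_ifs at h4 hne h5 <;> omega
  · rw [mem_removeCorner] at *
    obtain ⟨-, h1⟩ := Finset.mem_erase.1 h1
    obtain ⟨-, h2⟩ := Finset.mem_erase.1 h2
    have n1 := h.ne h1
    have n2 := h.ne h2
    simp only [swapLabels] at *
    refine Finset.mem_erase.2 ⟨?_, h.isLeSet.le_rule _ _ _ _ ?_ ?_ ?_ h1 h2⟩
    all_goals
      simp only [Equiv.swap_apply_def, ne_eq, Prod.mk.injEq] at n1 n2 ⊢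
      split_ifs at n1 n2 ⊢ <;> omega

theorem isPath_removeCorner (h : HasCorner n i S P) (hl : IsPath P Q l) (hc : ¬ Q (i, i + 1))
    (hQ : ∀ t ∈ P.erase (i, i + 1), Q' (swapLabels i t) ↔ Q t) :
    IsPath (removeCorner i P) Q' (l.map (swapLabels i)) := by
  refine (hl.erase hc fun s hs hn => ?_).map rfl
    (fun s hs t ht => h.strictlyNW_iff (Finset.mem_of_mem_erase hs) (Finset.mem_of_mem_erase ht))
    (fun s hs t ht => h.weaklyNW_iff (Finset.mem_of_mem_erase hs) (Finset.mem_of_mem_erase ht)) hQ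
  -- A square strictly southeast of the corner would have row at least `i + 1` and column at most
  -- `i`, against row `<` column.
  have := (h.isLeSet.mem s hs).2.2.2
  simp only [StrictlyNW] at hn
  omega

theorem path_removeCorner (h : HasCorner n i S P) (hk : k ≠ i + 1) :
    path (removeCorner i P) k = (path P k).map (swapLabels i) := by
  refine (h.isPath_removeCorner (h.isLeSet.isPath k) ?_ fun t ht => ?_).path_eq
  · simp only [Around]
    omega
  · have := h.ne (Finset.mem_of_mem_erase ht)
    simp only [Around, swapLabels, Equiv.swap_apply_def]
    split_ifs <;> omega

/-- A `+` in the corner is the first square of its path. After removal, the squares around the same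
border point are the relabelled ones strictly northwest of the corner, so exactly the tail of the
path remains. -/
theorem path_of_mem (h : HasCorner n i S P) (hc : (i, i + 1) ∈ P) :
    ∃ l, path P (i + 1) = (i, i + 1) :: l ∧
      path (removeCorner i P) (i + 1) = l.map (swapLabels i) ∧
      ∀ t ∈ l, t.1 < i ∧ i + 1 < t.2 := by
  have hn : IsNearest P (Around (i + 1)) (i, i + 1) := by
    refine ⟨⟨hc, by simp [Around]⟩, fun t ht hQ => ?_⟩
    simp only [Around, WeaklyNW] at *
    omega
  have hp := h.isLeSet.isPath (i + 1)
  generalize hL : path P (i + 1) = L at hp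
  cases hp with
  | nil _ h' => exact absurd hn.1.2 (h' _ hc)
  | cons _ s l hs hl =>
    obtain rfl := hn.unique hs
    refine ⟨l, rfl, (h.isPath_removeCorner hl ?_ fun t ht => ?_).path_eq, ?_⟩
    · simp [StrictlyNW]
    · obtain ⟨hne, ht⟩ := Finset.mem_erase.1 ht
      have h1 := h.ne ht
      have h2 := (h.isLeSet.mem t ht).2.2.2
      have h3 : ¬ (t.1 = i ∧ t.2 = i + 1) := fun h => hne (Prod.ext h.1 h.2)
      simp only [Around, StrictlyNW, swapLabels, Equiv.swap_apply_def]
      split_ifs <;> omega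
    · exact hl.region fun u v hu hv => ⟨hv.1.trans hu.1, hu.2.trans hv.2⟩

theorem path_congr (h : HasCorner n i S P) {m : ℕ} (hQ : ∀ t ∈ P, Around m t ↔ Around k t) :
    path P m = path P k :=
  ((h.isLeSet.isPath k).congr hQ).path_eq

/-- A `+` further left in row `i` and a `+` further up in column `i + 1` would force a `+` in the
corner. -/
theorem row_or_col_empty (h : HasCorner n i S P) (hc : (i, i + 1) ∉ P) :
    (∀ t ∈ P, t.1 ≠ i) ∨ ∀ t ∈ P, t.2 ≠ i + 1 := by
  by_contra! h'
  obtain ⟨⟨t, ht, rfl⟩, ⟨u, hu, hu2⟩⟩ := h'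
  have h1 := h.isLeSet.mem t ht
  have h2 := h.isLeSet.mem u hu
  have h3 : t.2 ≠ t.1 + 1 := fun he => hc (he ▸ ht)
  have h4 : u.1 ≠ t.1 := fun he => hc (by rwa [← hu2, ← he])
  refine hc (h.isLeSet.le_rule u.1 (t.1 + 1) t.1 t.2 (by omega) (by omega) (by omega) ?_ ht)
  rwa [← hu2]

/-- Consecutive starting regions `Around m` and `Around (m + 1)` differ only in row `m` and column
`m`. Row `i` has no `+`, and after removal it is row `i + 1`. -/
theorem path_of_row_empty (h : HasCorner n i S P) (hr : ∀ t ∈ P, t.1 ≠ i) :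
    path P (i + 1) = path P i ∧ path (removeCorner i P) (i + 1) =
      path (removeCorner i P) (i + 2) := by
  refine ⟨h.path_congr fun t ht => ?_,
    ((h.isLeSet_removeCorner.isPath (i + 2)).congr fun t ht => ?_).path_eq⟩
  · have := hr t ht
    have := h.ne ht
    simp only [Around]
    omega
  · have ht := Finset.mem_of_mem_erase (mem_removeCorner.1 ht)
    have h1 := hr _ ht
    have h2 := h.ne ht
    simp only [swapLabels, Equiv.swap_apply_def] at h1 h2
    simp only [Around]
    split_ifs at h1 h2 <;> omega

theorem path_of_col_empty (h : HasCorner n i S P) (hr : ∀ t ∈ P, t.2 ≠ i + 1) :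
    path P (i + 1) = path P (i + 2) ∧ path (removeCorner i P) (i + 1) =
      path (removeCorner i P) i := by
  refine ⟨h.path_congr fun t ht => ?_,
    ((h.isLeSet_removeCorner.isPath i).congr fun t ht => ?_).path_eq⟩
  · have := hr t ht
    have := h.ne ht
    simp only [Around]
    omega
  · have ht := Finset.mem_of_mem_erase (mem_removeCorner.1 ht)
    have h1 := hr _ ht
    have h2 := h.ne ht
    simp only [swapLabels, Equiv.swap_apply_def] at h1 h2
    simp only [Around]
    split_ifs at h1 h2 <;> omega

theorem neck_removeCorner (h : HasCorner n i S P) (hk : k ≠ i + 1) :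
    neck (S.image (Equiv.swap i (i + 1))) (removeCorner i P) k =
      (neck S P k).image (Equiv.swap i (i + 1)) := by
  rw [neck, h.path_removeCorner hk, exch_map_swapLabels, neck]

theorem neck_of_mem (h : HasCorner n i S P) (hc : (i, i + 1) ∈ P) :
    neck (S.image (Equiv.swap i (i + 1))) (removeCorner i P) (i + 1) = neck S P (i + 1) ∧
      i ∉ neck S P (i + 1) ∧ i + 1 ∈ neck S P (i + 1) := by
  obtain ⟨l, h1, h2, h3⟩ := h.path_of_mem hc
  have hi := h.mem
  have hi1 := h.notMem
  have e : ∀ t ∈ l, t.1 ≠ i ∧ t.1 ≠ i + 1 ∧ t.2 ≠ i ∧ t.2 ≠ i + 1 := fun t ht => by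
    have := h3 t ht
    omega
  have m1 : i ∈ exch S l := mem_exch.2 (.inl ⟨hi, fun t ht => (e t ht).1⟩)
  have m2 : i + 1 ∉ exch S l := by
    rw [mem_exch]
    rintro (⟨h, _⟩ | ⟨t, ht, h⟩)
    · exact hi1 h
    · exact (e t ht).2.2.2 h
  have m3 : neck S P (i + 1) = insert (i + 1) ((exch S l).erase i) := by
    rw [neck, h1]
    ext x
    simp only [mem_exch, Finset.mem_insert, Finset.mem_erase, List.mem_cons, forall_eq_or_imp,
      exists_eq_or_imp]
    have : ∀ t ∈ l, t.2 = x → x ≠ i := fun t ht hx => hx ▸ (e t ht).2.2.1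
    grind
  refine ⟨?_, ?_, ?_⟩
  -- Trading row `i` for column `i + 1` on the old path has the same effect as the exchange of
  -- labels on the new one.
  · rw [m3, neck, h2, exch_map_swapLabels]
    ext x
    simp only [Finset.mem_insert, Finset.mem_erase, mem_image_swap, Equiv.swap_apply_def]
    split_ifs with hx hx <;> simp_all
  · simp [m3]
  · simp [m3]

theorem cornerRel (h : HasCorner n i S P) :
    CornerRel i (neck S P) (neck (S.image (Equiv.swap i (i + 1))) (removeCorner i P)) := by
  refine ⟨fun k hk => h.neck_removeCorner hk, ?_⟩
  by_cases hc : (i, i + 1) ∈ P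
  · exact .inl (h.neck_of_mem hc)
  rcases h.row_or_col_empty hc with he | he
  · have := h.path_of_row_empty he
    simp only [neck, this]
    simp
  · have := h.path_of_col_empty he
    simp only [neck, this]
    simp

end HasCorner

/-! ### Induction over corners -/

/-- Removing a corner moves an element of `S` from `i` to `i + 1`, which lowers the sum of the `n -
x`. Sets without a corner are closed upwards in `[n]` and belong to diagrams without squares. -/
theorem corner_induction {motive : Finset ℕ → Prop}
    (base : ∀ S ⊆ Finset.Icc 1 n, (∀ i, i + 1 ≤ n → i ∈ S → i + 1 ∈ S) → motive S)
    (step : ∀ S ⊆ Finset.Icc 1 n, ∀ i, i + 1 ≤ n → i ∈ S → i + 1 ∉ S →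
      motive (S.image (Equiv.swap i (i + 1))) → motive S)
    (S : Finset ℕ) (hS : S ⊆ Finset.Icc 1 n) : motive S := by
  induction hN : ∑ x ∈ S, (n - x) using Nat.strong_induction_on generalizing S with
  | _ N ih =>
    by_cases h : ∀ i, i + 1 ≤ n → i ∈ S → i + 1 ∈ S
    · exact base S hS h
    push Not at h
    obtain ⟨i, hin, hi, hi1⟩ := h
    have hpos := (Finset.mem_Icc.1 (hS hi)).1
    refine step S hS i hin hi hi1 (ih _ ?_ _ ?_ rfl)
    · rw [← hN, Finset.sum_image (Equiv.injective _).injOn]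
      refine Finset.sum_lt_sum (fun x hx => ?_) ⟨i, hi, ?_⟩
      · have : x ≠ i + 1 := fun h => hi1 (h ▸ hx)
        rw [Equiv.swap_apply_def]
        split_ifs <;> omega
      · rw [Equiv.swap_apply_left]
        omega
    · intro x hx
      simpa using swap_mem_Icc hpos hin _ (hS (mem_image_swap.1 hx))

theorem mem_of_mem_of_le (hS : ∀ i, i + 1 ≤ n → i ∈ S → i + 1 ∈ S) {a b : ℕ} (hab : a ≤ b)
    (hb : b ≤ n) (ha : a ∈ S) : b ∈ S := by
  induction b, hab using Nat.le_induction with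
  | base => exact ha
  | succ b _ ih => exact hS b hb (ih (by omega))

theorem IsLeSet.eq_empty (hP : IsLeSet n S P) (hS : ∀ i, i + 1 ≤ n → i ∈ S → i + 1 ∈ S) :
    P = ∅ := by
  refine Finset.eq_empty_of_forall_notMem fun t ht => ?_
  obtain ⟨h1, h2, h3, h4⟩ := hP.mem t ht
  exact h3 (mem_of_mem_of_le hS h4.le (Finset.mem_Icc.1 h2).2 h1)

theorem neck_empty : neck S ∅ k = S := by
  have : path ∅ k = [] := (IsPath.nil (P := ∅) (Around k) (by simp)).path_eq
  simp [neck, exch, this]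

theorem isLeSet_empty (hS : S ⊆ Finset.Icc 1 n) : IsLeSet n S ∅ :=
  ⟨hS, by simp, by simp⟩

theorem IsLeSet.necklaceStep (hP : IsLeSet n S P) :
    ∀ k ∈ Finset.Icc 1 n, NecklaceStep n k (neck S P k) (neck S P (k + 1)) := by
  refine corner_induction (n := n)
    (motive := fun S => ∀ {P}, IsLeSet n S P →
      ∀ k ∈ Finset.Icc 1 n, NecklaceStep n k (neck S P k) (neck S P (k + 1)))
    (fun S _ hS P hP k hk => ?_) (fun S _ i hin hi hi1 ih P hP => ?_) S hP.subset hP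
  · rw [hP.eq_empty hS, neck_empty, neck_empty]
    exact .refl hk S
  · have h : HasCorner n i S P := ⟨hP, hin, hi, hi1⟩
    exact h.cornerRel.symm.necklaceStep h.pos hin (ih h.isLeSet_removeCorner)

/-- By corner induction: a corner `+` starts its own path, and every path of the smaller diagram is,
up to labels, contained in a path of the larger one. -/
theorem IsLeSet.exists_mem_path (hP : IsLeSet n S P) : ∀ t ∈ P, ∃ k, t ∈ path P k := by
  refine corner_induction (n := n)
    (motive := fun S => ∀ {P}, IsLeSet n S P → ∀ t ∈ P, ∃ k, t ∈ path P k)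
    (fun S _ hS P hP t ht => ?_) (fun S _ i hin hi hi1 ih P hP t ht => ?_) S hP.subset hP
  · simp [hP.eq_empty hS] at ht
  · have h : HasCorner n i S P := ⟨hP, hin, hi, hi1⟩
    by_cases htc : t = (i, i + 1)
    · subst htc
      obtain ⟨l, hl, -⟩ := h.path_of_mem ht
      exact ⟨i + 1, by simp [hl]⟩
    obtain ⟨k, hk⟩ := ih h.isLeSet_removeCorner (swapLabels i t)
      (mem_removeCorner.2 (by rw [swapLabels_swapLabels]; exact Finset.mem_erase.2 ⟨htc, ht⟩))
    have hmap : ∀ l : List (ℕ × ℕ), swapLabels i t ∈ l.map (swapLabels i) → t ∈ l := by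
      intro l hl
      obtain ⟨u, hu, hut⟩ := List.mem_map.1 hl
      rwa [← swapLabels_swapLabels (i := i) t, ← hut, swapLabels_swapLabels]
    by_cases hki : k = i + 1
    · subst hki
      by_cases hc : (i, i + 1) ∈ P
      · obtain ⟨l, h1, h2, -⟩ := h.path_of_mem hc
        exact ⟨i + 1, by rw [h1]; exact List.mem_cons_of_mem _ (hmap l (h2 ▸ hk))⟩
      rcases h.row_or_col_empty hc with he | he
      · rw [(h.path_of_row_empty he).2, h.path_removeCorner (by omega)] at hk
        exact ⟨_, hmap _ hk⟩
      · rw [(h.path_of_col_empty he).2, h.path_removeCorner (by omega)] at hk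
        exact ⟨_, hmap _ hk⟩
    · rw [h.path_removeCorner hki] at hk
      exact ⟨_, hmap _ hk⟩

theorem IsLeSet.biUnion_pairedSquares (hP : IsLeSet n S P) :
    ((Finset.Icc 2 n).biUnion fun k => pairedSquares S (neck S P k)) = P := by
  ext t
  simp only [Finset.mem_biUnion, hP.pairedSquares_neck, List.mem_toFinset]
  constructor
  · rintro ⟨k, _, ht⟩
    exact (hP.isPath k).mem t ht
  · intro ht
    obtain ⟨k, hk⟩ := hP.exists_mem_path t ht
    refine ⟨k, ?_, hk⟩
    by_contra hk'
    rw [Finset.mem_Icc] at hk'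
    rw [hP.path_eq_nil (by omega)] at hk
    simp at hk

/-! ### Every necklace comes from a Le diagram -/

/-- Grassmann necklaces starting with `S`, extended by `I (n + 1) = I 1`. -/
structure IsNecklaceFrom (n : ℕ) (S : Finset ℕ) (I : ℕ → Finset ℕ) : Prop where
  first : I 1 = S
  last : I (n + 1) = S
  subset : ∀ k, 1 ≤ k → k ≤ n + 1 → I k ⊆ Finset.Icc 1 n
  card : ∀ k, 1 ≤ k → k ≤ n + 1 → (I k).card = S.card
  step : ∀ k ∈ Finset.Icc 1 n, NecklaceStep n k (I k) (I (k + 1))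

namespace IsNecklaceFrom

variable {I I' : ℕ → Finset ℕ}

theorem mem_of_le (hI : IsNecklaceFrom n S I) {a : ℕ} (h1 : 1 ≤ k) (hk : k ≤ n + 1) (ha : a ∈ S)
    (hka : k ≤ a) : a ∈ I k :=
  mem_of_mem_of_necklaceStep hI.step le_rfl h1 hk (.inr hka) (hI.first ▸ ha)

theorem le_of_notMem (hI : IsNecklaceFrom n S I) {b : ℕ} (h1 : 1 ≤ k) (hk : k ≤ n + 1)
    (hb : b ∈ I k) (hbS : b ∉ S) : k ≤ b := by
  by_contra hlt
  have := mem_of_mem_of_necklaceStep hI.step h1 hk le_rfl (.inl (not_le.1 hlt)) hb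
  exact hbS (hI.last ▸ this)

/-- Elements of `S` missing from `I k` lie below `k`, new elements lie at or above `k`. If `S` is
closed upwards, the presence of the former excludes the latter, and the cardinalities agree. -/
theorem eq_of_upper (hI : IsNecklaceFrom n S I) (hS : ∀ i, i + 1 ≤ n → i ∈ S → i + 1 ∈ S)
    (h1 : 1 ≤ k) (hk : k ≤ n + 1) : I k = S := by
  have hcard := hI.card k h1 hk
  by_cases hsub : S ⊆ I k
  · exact (Finset.eq_of_subset_of_card_le hsub hcard.le).symm
  obtain ⟨a, haS, ha⟩ := Finset.not_subset.1 hsub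
  have hak : a < k := by
    by_contra hlt
    exact ha (hI.mem_of_le h1 hk haS (not_lt.1 hlt))
  refine Finset.eq_of_subset_of_card_le (fun b hb => ?_) hcard.ge
  by_contra hbS
  have hkb := hI.le_of_notMem h1 hk hb hbS
  have hbn := (Finset.mem_Icc.1 (hI.subset k h1 hk hb)).2
  exact hbS (mem_of_mem_of_le hS (by omega) hbn haS)

theorem of_cornerRel (hI : IsNecklaceFrom n S I) (hi : 1 ≤ i) (hin : i + 1 ≤ n)
    (h : CornerRel i I I') : IsNecklaceFrom n (S.image (Equiv.swap i (i + 1))) I' := by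
  have hsub : ∀ J : Finset ℕ, J ⊆ Finset.Icc 1 n →
      J.image (Equiv.swap i (i + 1)) ⊆ Finset.Icc 1 n := fun J hJ x hx => by
    simpa using swap_mem_Icc hi hin _ (hJ (mem_image_swap.1 hx))
  have hcard : ∀ J : Finset ℕ, (J.image (Equiv.swap i (i + 1))).card = J.card := fun J =>
    Finset.card_image_of_injective _ (Equiv.injective _)
  -- Up to the exchange, every term of `I'` is a term of `I`, so bounds and cardinalities carry
  -- over.
  have key : ∀ k, 1 ≤ k → k ≤ n + 1 → ∃ m, 1 ≤ m ∧ m ≤ n + 1 ∧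
      (I' k = I m ∨ I' k = (I m).image (Equiv.swap i (i + 1))) := by
    intro k h1 hk
    by_cases hki : k = i + 1
    · subst hki
      rcases h.2 with ⟨h2, -⟩ | ⟨-, h2⟩ | ⟨-, h2⟩
      · exact ⟨i + 1, h1, hk, .inl h2⟩
      · exact ⟨i + 2, by omega, by omega, .inr (h2.trans (h.1 _ (by omega)))⟩
      · exact ⟨i, by omega, by omega, .inr (h2.trans (h.1 _ (by omega)))⟩
    · exact ⟨k, h1, hk, .inr (h.1 k hki)⟩
  refine ⟨by rw [h.1 1 (by omega), hI.first], by rw [h.1 (n + 1) (by omega), hI.last], ?_, ?_,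
    h.necklaceStep hi hin hI.step⟩ <;> intro k h1 hk
  · obtain ⟨m, m1, m2, hm | hm⟩ := key k h1 hk <;> rw [hm]
    · exact hI.subset m m1 m2
    · exact hsub _ (hI.subset m m1 m2)
  · obtain ⟨m, m1, m2, hm | hm⟩ := key k h1 hk <;> rw [hm, hcard]
    · exact hI.card m m1 m2
    · rw [hcard, hI.card m m1 m2]

/-- The possible shapes of a necklace at a corner. -/
theorem corner_cases (hI : IsNecklaceFrom n S I) (hi : i ∈ S) (hi1 : 1 ≤ i) (hin : i + 1 ≤ n) :
    (i ∉ I (i + 1) ∧ i + 1 ∈ I (i + 1)) ∨ I (i + 1) = I i ∨ I (i + 1) = I (i + 2) := by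
  by_cases h1 : i ∈ I (i + 1)
  · obtain ⟨j, -, hj⟩ := (hI.step i (Finset.mem_Icc.2 (by omega))).1
      (hI.mem_of_le hi1 (by omega) hi le_rfl)
    rw [hj] at h1
    obtain rfl : i = j := by simpa using h1
    refine .inr (.inl ?_)
    rw [hj, Finset.insert_erase (hI.mem_of_le hi1 (by omega) hi le_rfl)]
  · by_cases h2 : i + 1 ∈ I (i + 1)
    · exact .inl ⟨h1, h2⟩
    · exact .inr (.inr ((hI.step (i + 1) (Finset.mem_Icc.2 (by omega))).2 h2).symm)

theorem exists_cornerRel (hI : IsNecklaceFrom n S I) (hi : i ∈ S) (hi1 : 1 ≤ i)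
    (hin : i + 1 ≤ n) : ∃ I', CornerRel i I I' := by
  let F : Finset ℕ → ℕ → Finset ℕ := fun J k =>
    if k = i + 1 then J else (I k).image (Equiv.swap i (i + 1))
  have hF : ∀ J k, k ≠ i + 1 → F J k = (I k).image (Equiv.swap i (i + 1)) :=
    fun J k hk => if_neg hk
  have hF' : ∀ J, F J (i + 1) = J := fun J => if_pos rfl
  rcases hI.corner_cases hi hi1 hin with h | h | h
  · exact ⟨F (I (i + 1)), hF _, .inl ⟨hF' _, h⟩⟩
  · refine ⟨F ((I (i + 2)).image (Equiv.swap i (i + 1))), hF _, .inr (.inl ⟨h, ?_⟩)⟩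
    rw [hF', hF _ _ (by omega)]
  · refine ⟨F ((I i).image (Equiv.swap i (i + 1))), hF _, .inr (.inr ⟨h, ?_⟩)⟩
    rw [hF', hF _ _ (by omega)]

end IsNecklaceFrom

/-- Row `k` is the lowest row that the path from border point `k + 1` can see. A `+` in it would
make the path start in that row and remove `k`. -/
theorem IsLeSet.row_empty (hP : IsLeSet n S P) (hk : k ∈ neck S P (k + 1)) :
    ∀ t ∈ P, t.1 ≠ k := by
  rintro t ht rfl
  obtain ⟨h1, h2, h3, h4⟩ := hP.mem t ht
  obtain ⟨s, hs⟩ := hP.exists_nearest (le_refl (t.1 + 1)) ⟨t, ht, by omega, by omega⟩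
  have hp := hP.isPath (t.1 + 1)
  rw [neck] at hk
  generalize path P (t.1 + 1) = L at hp hk
  cases hp with
  | nil _ h' => exact h' _ ht ⟨by omega, by omega⟩
  | cons _ u l hu hl =>
    obtain rfl := hs.unique hu
    have hst := (hs.2 t ht ⟨by omega, by omega⟩).1
    have hs1 := hs.1.2.1
    rcases mem_exch.1 hk with ⟨_, h⟩ | ⟨v, hv, h⟩
    · exact h s (by simp) (by omega)
    · have hvP : v ∈ P := (IsPath.cons _ _ _ hu hl).mem v hv
      exact (hP.mem v hvP).2.2.1 (h ▸ h1)

theorem IsLeSet.col_empty (hP : IsLeSet n S P) (hk : k ∉ neck S P k) : ∀ t ∈ P, t.2 ≠ k := by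
  rintro t ht rfl
  obtain ⟨h1, h2, h3, h4⟩ := hP.mem t ht
  obtain ⟨s, hs⟩ := hP.exists_nearest (le_refl t.2) ⟨t, ht, by omega, le_rfl⟩
  have hp := hP.isPath t.2
  rw [neck] at hk
  generalize path P t.2 = L at hp hk
  cases hp with
  | nil _ h' => exact h' _ ht ⟨by omega, le_rfl⟩
  | cons _ u l hu hl =>
    obtain rfl := hs.unique hu
    have hst := (hs.2 t ht ⟨by omega, le_rfl⟩).2
    have hs1 := hs.1.2.2
    exact hk (mem_exch.2 (.inr ⟨s, by simp, by omega⟩))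

/-- Adding a corner creates only one new instance of the Le rule's conclusion, the corner itself;
`hc` settles it. -/
theorem IsLeSet.of_removeCorner (hP : IsLeSet n (S.image (Equiv.swap i (i + 1))) (removeCorner i P))
    (hS : S ⊆ Finset.Icc 1 n) (hin : i + 1 ≤ n) (hi : i ∈ S) (hi1 : i + 1 ∉ S)
    (hc : (i, i + 1) ∈ P ∨ (∀ t ∈ P, t.1 ≠ i) ∨ ∀ t ∈ P, t.2 ≠ i + 1) : IsLeSet n S P := by
  have hpos := (Finset.mem_Icc.1 (hS hi)).1
  have hmem : ∀ t ∈ P, t ≠ (i, i + 1) → swapLabels i t ∈ removeCorner i P := fun t ht hne =>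
    mem_removeCorner.2 (by rw [swapLabels_swapLabels]; exact Finset.mem_erase.2 ⟨hne, ht⟩)
  have hlab : ∀ t ∈ P, t.1 ∈ S ∧ t.2 ∈ Finset.Icc 1 n ∧ t.2 ∉ S ∧ t.1 < t.2 := by
    intro t ht
    by_cases hne : t = (i, i + 1)
    · subst hne
      exact ⟨hi, Finset.mem_Icc.2 ⟨by omega, hin⟩, hi1, by simp⟩
    obtain ⟨h1, h2, h3, h4⟩ := hP.mem _ (hmem t ht hne)
    have h2' := swap_mem_Icc hpos hin _ h2
    simp only [swapLabels, mem_image_swap, Equiv.swap_apply_self] at h1 h2' h3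
    refine ⟨h1, h2', h3, ?_⟩
    have n1 : t.1 ≠ i + 1 := fun he => hi1 (he ▸ h1)
    have n2 : t.2 ≠ i := fun he => h3 (he ▸ hi)
    simp only [swapLabels, Equiv.swap_apply_def] at h4
    split_ifs at h4 <;> omega
  refine ⟨hS, hlab, fun a b c d hac hbd hcb h1 h2 => ?_⟩
  have l1 := hlab _ h1
  have l2 := hlab _ h2
  by_cases hcorner : (c, b) = (i, i + 1)
  · rw [hcorner]
    simp only [Prod.mk.injEq] at hcorner
    rcases hc with h | h | h
    · exact h
    · exact absurd hcorner.1 (h _ h2)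
    · exact absurd hcorner.2 (h _ h1)
  have m1 := hmem _ h1 (by simp only [ne_eq, Prod.mk.injEq]; omega)
  have m2 := hmem _ h2 (by simp only [ne_eq, Prod.mk.injEq]; omega)
  have a1 : a ≠ i + 1 := fun he => hi1 (he ▸ l1.1)
  have c1 : c ≠ i + 1 := fun he => hi1 (he ▸ l2.1)
  have b1 : b ≠ i := fun he => l1.2.2.1 (he ▸ hi)
  have d1 : d ≠ i := fun he => l2.2.2.1 (he ▸ hi)
  have := hP.le_rule _ _ _ _ ?_ ?_ ?_ m1 m2
  · have h3 := Finset.mem_of_mem_erase (mem_removeCorner.1 this)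
    exact swapLabels_swapLabels (i := i) (c, b) ▸ h3
  all_goals
    simp only [Prod.mk.injEq, Equiv.swap_apply_def] at hcorner ⊢
    split_ifs <;> omega

theorem removeCorner_eq
    (h : P.erase (i, i + 1) = P'.image (swapLabels i)) : removeCorner i P = P' := by
  ext t
  rw [mem_removeCorner, h, mem_image_swapLabels, swapLabels_swapLabels]

theorem exists_neck_eq (S : Finset ℕ) (hS : S ⊆ Finset.Icc 1 n) :
    ∀ I, IsNecklaceFrom n S I →
      ∃ P, IsLeSet n S P ∧ ∀ k, 1 ≤ k → k ≤ n + 1 → neck S P k = I k := by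
  refine corner_induction (motive := fun S => ∀ I, IsNecklaceFrom n S I →
      ∃ P, IsLeSet n S P ∧ ∀ k, 1 ≤ k → k ≤ n + 1 → neck S P k = I k)
    (fun S hS hup I hI => ?_) (fun S hS i hin hi hi1 ih I hI => ?_) S hS
  · exact ⟨∅, isLeSet_empty hS, fun k h1 hk => by rw [neck_empty, hI.eq_of_upper hup h1 hk]⟩
  · have hpos := (Finset.mem_Icc.1 (hS hi)).1
    obtain ⟨I', hrel⟩ := hI.exists_cornerRel hi hpos hin
    have hI' := hI.of_cornerRel hpos hin hrel
    obtain ⟨P', hP', hneck⟩ := ih I' hI'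
    have hc0 : (i, i + 1) ∉ P'.image (swapLabels i) := fun h => by
      have := (hP'.mem _ (mem_image_swapLabels.1 h)).2.2.2
      simp [swapLabels] at this
    -- Whatever the filling of the corner, all terms but term `i + 1` are correct by relabelling;
    -- the three cases only have to supply the Le rule at the corner and that one term.
    have finish : ∀ P, P.erase (i, i + 1) = P'.image (swapLabels i) →
        ((i, i + 1) ∈ P ∨ (∀ t ∈ P, t.1 ≠ i) ∨ ∀ t ∈ P, t.2 ≠ i + 1) →
        (HasCorner n i S P → neck S P i = I i → neck S P (i + 2) = I (i + 2) →
          neck S P (i + 1) = I (i + 1)) →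
        ∃ P, IsLeSet n S P ∧ ∀ k, 1 ≤ k → k ≤ n + 1 → neck S P k = I k := by
      intro P hPe hc hcor
      have hrem := removeCorner_eq hPe
      have hP := (hrem ▸ hP' :
        IsLeSet n (S.image (Equiv.swap i (i + 1))) (removeCorner i P)).of_removeCorner hS hin hi hi1 hc
      have h : HasCorner n i S P := ⟨hP, hin, hi, hi1⟩
      have hne : ∀ k, k ≠ i + 1 → 1 ≤ k → k ≤ n + 1 → neck S P k = I k := fun k hk h1 h2 => by
        rw [h.cornerRel.symm.1 k hk, hrem, hneck k h1 h2, ← hrel.symm.1 k hk]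
      refine ⟨P, hP, fun k h1 h2 => ?_⟩
      by_cases hk : k = i + 1
      · subst hk
        exact hcor h (hne _ (by omega) (by omega) (by omega))
          (hne _ (by omega) (by omega) (by omega))
      · exact hne k hk h1 h2
    rcases hrel.2 with ⟨e, -⟩ | ⟨e1, e2⟩ | ⟨e1, e2⟩
    · have hPe : (insert (i, i + 1) (P'.image (swapLabels i))).erase (i, i + 1) =
          P'.image (swapLabels i) := Finset.erase_insert hc0
      refine finish _ hPe (.inl (Finset.mem_insert_self _ _)) fun h _ _ => ?_
      rw [← (h.neck_of_mem (Finset.mem_insert_self _ _)).1, removeCorner_eq hPe,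
        hneck _ (by omega) (by omega), e]
    · have hrow : ∀ t ∈ P'.image (swapLabels i), t.1 ≠ i := by
        intro t ht he
        refine hP'.row_empty (k := i + 1) ?_ _ (mem_image_swapLabels.1 ht) (by simp [swapLabels, he])
        rw [hneck _ (by omega) (by omega), ← e2]
        exact hI'.mem_of_le (by omega) (by omega) (mem_image_swap.2 (by simpa using hi)) le_rfl
      refine finish _ (Finset.erase_eq_of_notMem hc0) (.inr (.inl hrow)) fun h hi _ => ?_
      rw [e1, ← hi, neck, (h.path_of_row_empty hrow).1, neck]
    · have hcol : ∀ t ∈ P'.image (swapLabels i), t.2 ≠ i + 1 := by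
        intro t ht he
        refine hP'.col_empty (k := i) ?_ _ (mem_image_swapLabels.1 ht) (by simp [swapLabels, he])
        rw [hneck _ (by omega) (by omega), ← e2]
        intro hmem
        have := hI'.le_of_notMem (by omega) (by omega) hmem
          (fun h => hi1 (by simpa using mem_image_swap.1 h))
        omega
      refine finish _ (Finset.erase_eq_of_notMem hc0) (.inr (.inr hcol)) fun h _ hi => ?_
      rw [e1, ← hi, neck, (h.path_of_col_empty hcol).1, neck]

/-! ### Labels of a Young diagram -/

section Labels

variable {μ : YoungDiagram}

theorem rowLen_le (h : Fits k n μ) (r : ℕ) : μ.rowLen r ≤ n - k := by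
  by_contra hlt
  have := (h _ ((YoungDiagram.mem_cells _).2 (YoungDiagram.mem_iff_lt_rowLen.2 (not_le.1 hlt)))).2
  simp at this

theorem colLen_le (h : Fits k n μ) (c : ℕ) : μ.colLen c ≤ k := by
  by_contra hlt
  have := (h _ ((YoungDiagram.mem_cells _).2 (YoungDiagram.mem_iff_lt_colLen.2 (not_le.1 hlt)))).1
  simp at this

theorem lt_rowLen_iff_lt_colLen {r c : ℕ} : c < μ.rowLen r ↔ r < μ.colLen c := by
  rw [← YoungDiagram.mem_iff_lt_rowLen, YoungDiagram.mem_iff_lt_colLen]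

theorem rowLabel_lt_rowLabel_iff (h : Fits k n μ) {r r' : ℕ} :
    rowLabel k n μ r < rowLabel k n μ r' ↔ r < r' := by
  have key : ∀ a b, a < b → rowLabel k n μ a < rowLabel k n μ b := fun a b hab => by
    have := μ.rowLen_anti a b hab.le
    have := rowLen_le h a
    unfold rowLabel
    omega
  refine ⟨fun hlt => ?_, key r r'⟩
  rcases lt_trichotomy r r' with h' | rfl | h'
  · exact h'
  · omega
  · have := key _ _ h'
    omega

theorem colLabel_lt_colLabel_iff {c c' : ℕ} (hc : c < n - k) (hc' : c' < n - k) :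
    colLabel k n μ c < colLabel k n μ c' ↔ c' < c := by
  have key : ∀ a b, a < b → b < n - k → colLabel k n μ b < colLabel k n μ a := fun a b hab hb => by
    have := μ.colLen_anti a b hab.le
    unfold colLabel
    omega
  refine ⟨fun hlt => ?_, fun hlt => key _ _ hlt hc⟩
  rcases lt_trichotomy c' c with h' | rfl | h'
  · exact h'
  · omega
  · have := key _ _ h' hc'
    omega

theorem rowLabel_lt_colLabel_iff (h : Fits k n μ) {r c : ℕ} (_hc : c < n - k) :
    rowLabel k n μ r < colLabel k n μ c ↔ c < μ.rowLen r := by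
  have h1 := rowLen_le h r
  have h2 := lt_rowLen_iff_lt_colLen (μ := μ) (r := r) (c := c)
  unfold rowLabel colLabel
  by_cases h3 : c < μ.rowLen r
  · have := h2.1 h3
    simp only [h3, iff_true]
    omega
  · have := fun h => h3 (h2.2 h)
    simp only [h3, iff_false]
    omega

theorem rowLabel_ne_colLabel (h : Fits k n μ) {r c : ℕ} (hc : c < n - k) :
    rowLabel k n μ r ≠ colLabel k n μ c := by
  have h1 := rowLen_le h r
  have h2 := lt_rowLen_iff_lt_colLen (μ := μ) (r := r) (c := c)
  unfold rowLabel colLabel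
  by_cases h3 : c < μ.rowLen r
  · have := h2.1 h3
    omega
  · have := fun h => h3 (h2.2 h)
    omega

theorem rowLabels_subset (hkn : k ≤ n) : rowLabels k n μ ⊆ Finset.Icc 1 n := by
  intro x hx
  obtain ⟨r, hr, rfl⟩ := Finset.mem_image.1 hx
  rw [Finset.mem_range] at hr
  rw [Finset.mem_Icc]
  unfold rowLabel
  omega

theorem card_rowLabels (h : Fits k n μ) : (rowLabels k n μ).card = k := by
  rw [rowLabels, Finset.card_image_of_injective, Finset.card_range]
  exact StrictMono.injective fun a b hab => (rowLabel_lt_rowLabel_iff h).2 hab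

theorem sdiff_rowLabels (hkn : k ≤ n) (h : Fits k n μ) :
    Finset.Icc 1 n \ rowLabels k n μ = (Finset.range (n - k)).image (colLabel k n μ) := by
  symm
  refine Finset.eq_of_subset_of_card_le (fun x hx => ?_) ?_
  · obtain ⟨c, hc, rfl⟩ := Finset.mem_image.1 hx
    rw [Finset.mem_range] at hc
    have := colLen_le h c
    refine Finset.mem_sdiff.2 ⟨?_, fun hx => ?_⟩
    · rw [Finset.mem_Icc]
      unfold colLabel
      omega
    · obtain ⟨r, -, hr⟩ := Finset.mem_image.1 hx
      exact rowLabel_ne_colLabel h hc hr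
  · rw [Finset.card_sdiff_of_subset (rowLabels_subset hkn), card_rowLabels h,
      Finset.card_image_of_injOn, Finset.card_range, Nat.card_Icc, Nat.add_sub_cancel]
    intro a ha b hb hab
    simp only [Finset.coe_range, Set.mem_Iio] at ha hb
    have h1 := colLabel_lt_colLabel_iff (μ := μ) ha hb
    have h2 := colLabel_lt_colLabel_iff (μ := μ) hb ha
    omega

/-- A row and a column meet in a square exactly when the row's vertical step comes before the
column's horizontal step on the border. -/
theorem mem_squares_iff (hkn : k ≤ n) (h : Fits k n μ) (t : ℕ × ℕ) :
    t ∈ squares k n μ ↔ t.1 ∈ rowLabels k n μ ∧ t.2 ∈ Finset.Icc 1 n \ rowLabels k n μ ∧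
      t.1 < t.2 := by
  rw [sdiff_rowLabels hkn h]
  constructor
  · intro ht
    obtain ⟨⟨r, c⟩, hc, rfl⟩ := Finset.mem_image.1 ht
    obtain ⟨h1, h2⟩ := h _ hc
    exact ⟨Finset.mem_image_of_mem _ (Finset.mem_range.2 h1),
      Finset.mem_image_of_mem _ (Finset.mem_range.2 h2),
      (rowLabel_lt_colLabel_iff h h2).2 (YoungDiagram.mem_iff_lt_rowLen.1 hc)⟩
  · rintro ⟨h1, h2, h3⟩
    obtain ⟨r, hr, h1⟩ := Finset.mem_image.1 h1
    obtain ⟨c, hc, h2⟩ := Finset.mem_image.1 h2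
    rw [← h1, ← h2, rowLabel_lt_colLabel_iff h (Finset.mem_range.1 hc)] at h3
    exact Finset.mem_image.2 ⟨(r, c), YoungDiagram.mem_iff_lt_rowLen.2 h3, Prod.ext h1 h2⟩

theorem isLe_iff_isLeSet (hkn : k ≤ n) {D : Diagram} (h : Fits k n D.shape) :
    D.IsLe k n ↔ IsLeSet n (rowLabels k n D.shape) D.plus := by
  have hsq := mem_squares_iff hkn h
  constructor
  · intro hD
    have hmem := fun t ht => (hsq t).1 (hD.plus_subset ht)
    simp only [Finset.mem_sdiff] at hmem
    refine ⟨rowLabels_subset hkn, fun t ht => ⟨(hmem t ht).1, (hmem t ht).2.1.1,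
      (hmem t ht).2.1.2, (hmem t ht).2.2⟩, fun a b c d hac hbd hcb h1 h2 => ?_⟩
    exact hD.le_rule a b c d hac hbd h1 h2
      ((hsq _).2 ⟨(hmem _ h2).1, Finset.mem_sdiff.2 (hmem _ h1).2.1, hcb⟩)
  · intro hP
    refine ⟨h, fun t ht => ?_, fun a b c d hac hbd h1 h2 h3 =>
      hP.le_rule a b c d hac hbd ((hsq _).1 h3).2.2 h1 h2⟩
    obtain ⟨h1, h2, h3, h4⟩ := hP.mem t ht
    exact (hsq t).2 ⟨h1, Finset.mem_sdiff.2 ⟨h2, h3⟩, h4⟩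

theorem weaklyNW_label_iff (h : Fits k n μ) {c : ℕ × ℕ} (hc : IsBoundarySquare k n μ i c)
    (ht : t ∈ squares k n μ) : WeaklyNW t (label k n μ c) ↔ Around i t := by
  obtain ⟨⟨r', c'⟩, hc', rfl⟩ := Finset.mem_image.1 ht
  obtain ⟨r, c⟩ := c
  obtain ⟨h1, h2, h3⟩ := hc
  have h4 := (h _ h1).2
  have h5 := (h _ hc').2
  simp only at h2 h3 h4 h5
  have e1 := YoungDiagram.mem_iff_lt_rowLen.1 h1
  have e2 := YoungDiagram.mem_iff_lt_colLen.1 h1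
  have e3 : ¬ c + 1 < μ.rowLen (r + 1) := fun hh => h2 (YoungDiagram.mem_iff_lt_rowLen.2 hh)
  have e4 : ¬ r + 1 < μ.colLen (c + 1) := fun hh => h2 (YoungDiagram.mem_iff_lt_colLen.2 hh)
  simp only [WeaklyNW, Around, label]
  rw [← not_lt, ← not_lt, rowLabel_lt_rowLabel_iff h, colLabel_lt_colLabel_iff h5 h4]
  have a1 := rowLen_le h r
  have a2 := rowLen_le h r'
  refine and_congr ?_ ?_ <;> rw [not_lt]
  · unfold rowLabel
    rcases le_or_gt r' r with hr | hr
    · have := μ.rowLen_anti r' r hr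
      simp only [hr, true_iff]
      omega
    · have := μ.rowLen_anti (r + 1) r' hr
      simp only [not_le.2 hr, false_iff]
      omega
  · unfold colLabel
    rcases le_or_gt c' c with hr | hr
    · have := μ.colLen_anti c' c hr
      simp only [hr, true_iff]
      omega
    · have := μ.colLen_anti (c + 1) c' hr
      simp only [not_le.2 hr, false_iff]
      omega

theorem exists_isBoundarySquare (h : Fits k n μ) (hkn : k ≤ n) (ht : t ∈ squares k n μ)
    (hi : Around i t) : ∃ c, IsBoundarySquare k n μ i c := by
  obtain ⟨⟨r', c'⟩, hc', rfl⟩ := Finset.mem_image.1 ht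
  obtain ⟨h1, h2⟩ := hi
  have hr' := h _ hc'
  simp only [label] at h1 h2 hr'
  have hne : ((Finset.range k).filter fun r => rowLabel k n μ r < i).Nonempty :=
    ⟨r', by simp [h1, hr'.1]⟩
  -- The boundary square sits in the last row whose vertical step precedes border point `i`; its
  -- column is then dictated by the numbering of boundary squares.
  obtain ⟨r, hr, hmax⟩ := Finset.exists_max_image _ id hne
  simp only [Finset.mem_filter, Finset.mem_range, id] at hr hmax
  have hrr := hmax r' ⟨hr'.1, h1⟩
  have b1 := rowLen_le h r
  have b2 := rowLen_le h (r + 1)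
  have b3 := colLen_le h c'
  have b4 := μ.rowLen_anti r (r + 1) (by omega)
  have hnext : r + 1 < k → i ≤ rowLabel k n μ (r + 1) := fun hk => by
    by_contra hlt
    have := hmax (r + 1) ⟨hk, not_le.1 hlt⟩
    omega
  have hlast : μ.rowLen (r + 1) = 0 → μ.colLen c' ≤ r + 1 := fun h0 => by
    by_contra hlt
    have := lt_rowLen_iff_lt_colLen.2 (not_le.1 hlt)
    omega
  have hout : ¬ r + 1 < k → μ.rowLen (r + 1) = 0 := fun hk => by
    by_contra h0
    have := (h _ ((YoungDiagram.mem_cells _).2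
      (YoungDiagram.mem_iff_lt_rowLen.2 (Nat.pos_of_ne_zero h0)))).1
    exact hk this
  unfold rowLabel at hr hnext
  unfold colLabel at h2
  have key : i ≤ n - k + r + 1 := by omega
  refine ⟨(r, n - k + r + 1 - i), (YoungDiagram.mem_cells _).2 (YoungDiagram.mem_iff_lt_rowLen.2 ?_),
    fun hmem => ?_, ?_⟩
  · omega
  · have := YoungDiagram.mem_iff_lt_rowLen.1 ((YoungDiagram.mem_cells _).1 hmem)
    simp only at this
    omega
  · simp only
    omega

end Labels

/-! ### The Young diagram with given row labels -/

theorem length_rowLensOf (n : ℕ) (S : Finset ℕ) : (rowLensOf n S).length = S.card := by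
  simp [rowLensOf]

theorem rowLen_shapeOf (hS : S.card = k) (r : Fin k) :
    (shapeOf n S).rowLen r =
      ((Finset.Icc 1 n \ S).filter fun b => S.orderEmbOfFin hS r < b).card := by
  have hr : (r : ℕ) < (rowLensOf n S).length := by rw [length_rowLensOf, hS]; exact r.2
  have h := YoungDiagram.rowLen_ofRowLens (hw := rowLensOf_sorted n S) ⟨r, hr⟩
  simp only [shapeOf, h, Finset.orderEmbOfFin_apply]
  simp [rowLensOf]
  rfl

theorem rowLen_shapeOf_of_le {r : ℕ} (hr : S.card ≤ r) : (shapeOf n S).rowLen r = 0 := by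
  by_contra h
  obtain ⟨h1, -⟩ := YoungDiagram.mem_ofRowLens.1
    (YoungDiagram.mem_iff_lt_rowLen.2 (Nat.pos_of_ne_zero h) : (r, 0) ∈ shapeOf n S)
  rw [length_rowLensOf] at h1
  exact absurd h1 (not_lt.2 hr)

theorem fits_shapeOf (hS : S ⊆ Finset.Icc 1 n) (hk : S.card = k) : Fits k n (shapeOf n S) := by
  rintro ⟨r, c⟩ hc
  have hc' := YoungDiagram.mem_iff_lt_rowLen.1 hc
  have hr : r < k := by
    by_contra h
    rw [rowLen_shapeOf_of_le (hk ▸ not_lt.1 h)] at hc'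
    omega
  refine ⟨hr, hc'.trans_le ?_⟩
  rw [rowLen_shapeOf hk ⟨r, hr⟩]
  refine (Finset.card_filter_le _ _).trans ?_
  rw [Finset.card_sdiff_of_subset hS, hk, Nat.card_Icc, Nat.add_sub_cancel]

theorem card_filter_lt_orderEmbOfFin (hS : S.card = k) (r : Fin k) :
    (S.filter fun a => a < S.orderEmbOfFin hS r).card = r := by
  have : (S.filter fun a => a < S.orderEmbOfFin hS r) =
      (Finset.Iio r).map (S.orderEmbOfFin hS).toEmbedding := by
    ext a
    simp only [Finset.mem_filter, Finset.mem_map, Finset.mem_Iio, RelEmbedding.coe_toEmbedding]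
    constructor
    · rintro ⟨h1, h2⟩
      rw [← Finset.mem_coe, ← Finset.range_orderEmbOfFin S hS] at h1
      obtain ⟨x, rfl⟩ := h1
      exact ⟨x, (OrderEmbedding.lt_iff_lt _).1 h2, rfl⟩
    · rintro ⟨x, hx, rfl⟩
      exact ⟨Finset.orderEmbOfFin_mem _ _ _, (OrderEmbedding.lt_iff_lt _).2 hx⟩
  rw [this, Finset.card_map, Fin.card_Iio]

/-- The numbers below the `r`-th element `x` of `S` are `r` elements of `S` and the non-elements not
counted in the row length, and there are `x - 1` of them. -/
theorem rowLabel_shapeOf (hS : S ⊆ Finset.Icc 1 n) (hk : S.card = k) (r : Fin k) :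
    rowLabel k n (shapeOf n S) r = S.orderEmbOfFin hk r := by
  rw [rowLabel, rowLen_shapeOf hk]
  have h1 := card_filter_lt_orderEmbOfFin hk r
  have hx := Finset.orderEmbOfFin_mem S hk r
  generalize S.orderEmbOfFin hk r = x at *
  have hxn := Finset.mem_Icc.1 (hS hx)
  have h2 : (Finset.Icc 1 n \ S).card = n - k := by
    rw [Finset.card_sdiff_of_subset hS, hk, Nat.card_Icc, Nat.add_sub_cancel]
  have h3 := Finset.card_filter_add_card_filter_not (s := Finset.Icc 1 n \ S) (fun b => x < b)
  have h4 : ((Finset.Icc 1 n).filter fun b => b < x).card = x - 1 := by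
    have : ((Finset.Icc 1 n).filter fun b => b < x) = Finset.Ico 1 x := by
      ext b
      simp only [Finset.mem_filter, Finset.mem_Icc, Finset.mem_Ico]
      omega
    rw [this, Nat.card_Ico]
  have h5 : ((Finset.Icc 1 n).filter fun b => b < x) =
      ((Finset.Icc 1 n \ S).filter fun b => ¬ x < b) ∪ S.filter fun b => b < x := by
    ext b
    by_cases hb : b ∈ S
    · have := hS hb
      simp [hb, this]
    · have : b ≠ x := fun h => hb (h ▸ hx)
      simp only [Finset.mem_filter, Finset.mem_union, Finset.mem_sdiff, hb, not_false_eq_true,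
        and_true, false_and, or_false, not_lt]
      refine and_congr_right fun _ => ?_
      omega
  rw [h5, Finset.card_union_of_disjoint] at h4
  · omega
  · rw [Finset.disjoint_left]
    intro b hb hb'
    exact (Finset.mem_sdiff.1 (Finset.mem_filter.1 hb).1).2 (Finset.mem_filter.1 hb').1

theorem rowLabels_shapeOf (hS : S ⊆ Finset.Icc 1 n) (hk : S.card = k) :
    rowLabels k n (shapeOf n S) = S := by
  refine Finset.eq_of_subset_of_card_le (fun x hx => ?_) ?_
  · obtain ⟨r, hr, rfl⟩ := Finset.mem_image.1 hx
    rw [rowLabel_shapeOf hS hk ⟨r, Finset.mem_range.1 hr⟩]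
    exact Finset.orderEmbOfFin_mem _ _ _
  · rw [card_rowLabels (fits_shapeOf hS hk), hk]

theorem shapeOf_rowLabels {μ : YoungDiagram} (hkn : k ≤ n) (h : Fits k n μ) :
    shapeOf n (rowLabels k n μ) = μ := by
  have hcard := card_rowLabels h
  have key : ∀ r, (shapeOf n (rowLabels k n μ)).rowLen r = μ.rowLen r := by
    intro r
    rcases lt_or_ge r k with hr | hr
    · have he : (fun r : Fin k => rowLabel k n μ r) = (rowLabels k n μ).orderEmbOfFin hcard :=
        Finset.orderEmbOfFin_unique hcard
          (fun r => Finset.mem_image_of_mem _ (Finset.mem_range.2 r.2))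
          fun a b hab => (rowLabel_lt_rowLabel_iff h).2 hab
      rw [rowLen_shapeOf hcard ⟨r, hr⟩, ← he, sdiff_rowLabels hkn h, Finset.filter_image,
        Finset.card_image_of_injOn]
      · have : ((Finset.range (n - k)).filter fun c => rowLabel k n μ r < colLabel k n μ c) =
            Finset.range (μ.rowLen r) := by
          ext c
          have := rowLen_le h r
          simp only [Finset.mem_filter, Finset.mem_range]
          constructor
          · rintro ⟨h1, h2⟩
            exact (rowLabel_lt_colLabel_iff h h1).1 h2
          · intro h1
            exact ⟨by omega, (rowLabel_lt_colLabel_iff h (by omega)).2 h1⟩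
        rw [this, Finset.card_range]
      · intro a ha b hb hab
        simp only [Finset.coe_filter, Finset.mem_range, Set.mem_ofPred_eq] at ha hb
        have h1 := colLabel_lt_colLabel_iff (μ := μ) ha.1 hb.1
        have h2 := colLabel_lt_colLabel_iff (μ := μ) hb.1 ha.1
        omega
    · rw [rowLen_shapeOf_of_le (by rwa [hcard])]
      by_contra h0
      have := (h _ ((YoungDiagram.mem_cells _).2
        (YoungDiagram.mem_iff_lt_rowLen.2 (Nat.pos_of_ne_zero (Ne.symm h0))))).1
      exact absurd this (not_lt.2 hr)
  ext ⟨r, c⟩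
  rw [YoungDiagram.mem_cells, YoungDiagram.mem_cells, YoungDiagram.mem_iff_lt_rowLen,
    YoungDiagram.mem_iff_lt_rowLen, key]

/-! ### Paths in a Le diagram -/

theorem IsPath.mem_of_isNearest (h : IsPath P Q l) (hs : s ∈ l)
    (ht : IsNearest P (fun u => StrictlyNW u s) t) : t ∈ l := by
  have head : ∀ {Q l}, IsPath P Q l → IsNearest P Q t → t ∈ l := by
    intro Q l hl ht
    cases hl with
    | nil _ h => exact absurd ht.1.2 (h t ht.1.1)
    | cons _ s l hs _ =>
      obtain rfl := ht.unique hs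
      simp
  induction h with
  | nil => simp at hs
  | cons Q u l hu hl ih =>
    rcases List.mem_cons.1 hs with rfl | hs
    · exact List.mem_cons_of_mem _ (head hl ht)
    · exact List.mem_cons_of_mem _ (ih hs)

theorem IsPath.forall_mem {M : ℕ × ℕ → Prop} (h : IsPath P Q l)
    (start : ∀ s, IsNearest P Q s → M s)
    (step : ∀ s t, M s → IsNearest P (fun u => StrictlyNW u s) t → M t) : ∀ s ∈ l, M s := by
  induction h with
  | nil => simp
  | cons Q u l hu hl ih =>
    intro s hs
    rcases List.mem_cons.1 hs with rfl | hs
    · exact start s hu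
    · exact ih (fun t ht => step u t (start u hu) ht) s hs

theorem IsNearest.congr (h : IsNearest P Q s) (hQ : ∀ t ∈ P, Q' t ↔ Q t) : IsNearest P Q' s :=
  ⟨⟨h.1.1, (hQ s h.1.1).2 h.1.2⟩, fun t ht hQt => h.2 t ht ((hQ t ht).1 hQt)⟩

theorem IsLe.inPath_iff {D : Diagram} (hkn : k ≤ n) (hD : D.IsLe k n) :
    InPath k n D i s ↔ s ∈ path D.plus i := by
  have hP := (isLe_iff_isLeSet hkn hD.fits).1 hD
  have hp := hP.isPath i
  constructor
  · intro h
    induction h with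
    | start c s hc hs =>
      have hs' : IsNearest D.plus (Around i) s := IsNearest.congr
        (Q := fun t => WeaklyNW t (label k n D.shape c)) hs fun t ht =>
        (weaklyNW_label_iff hD.fits hc (hD.plus_subset ht)).symm
      generalize path D.plus i = L at hp
      cases hp with
      | nil _ h => exact absurd hs'.1.2 (h s hs'.1.1)
      | cons _ u l hu _ =>
        obtain rfl := hs'.unique hu
        simp
    | step s t _ ht ih => exact hp.mem_of_isNearest ih ht
  · refine fun h => hp.forall_mem (M := InPath k n D i) (fun s hs => ?_)
      (fun s t hs ht => .step s t hs ht) s h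
    -- A boundary square is needed only when the path is nonempty, and then the `+` in the region
    -- guarantees one.
    obtain ⟨c, hc⟩ := exists_isBoundarySquare hD.fits hkn (hD.plus_subset hs.1.1) hs.1.2
    exact .start c s hc (hs.congr fun t ht =>
      weaklyNW_label_iff hD.fits hc (hD.plus_subset ht))

theorem IsLe.ohNecklace_eq {D : Diagram} (hkn : k ≤ n) (hD : D.IsLe k n) :
    D.ohNecklace k n i = neck (rowLabels k n D.shape) D.plus i := by
  have hP := (isLe_iff_isLeSet hkn hD.fits).1 hD
  by_cases hi : i = 1
  · rw [ohNecklace, if_pos hi, hP.neck_eq_self (.inl hi.le)]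
  have hlab := fun t ht => hP.mem t ((hP.isPath i).mem t ht)
  rw [ohNecklace, if_neg hi]
  ext x
  simp only [neck, mem_exch, hD.inPath_iff hkn, Finset.mem_union, Finset.mem_sdiff,
    Finset.mem_filter]
  refine or_congr (and_congr_right fun hx => ?_) ?_
  · have := hP.subset hx
    simp only [this, true_and, not_exists]
    exact ⟨fun h t ht he => h t.2 (he ▸ ht), fun h b hb => h _ hb rfl⟩
  · constructor
    · rintro ⟨_, a, ha⟩
      exact ⟨_, ha, rfl⟩
    · rintro ⟨t, ht, rfl⟩
      exact ⟨(hlab t ht).2.1, t.1, ht⟩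

/-! ### The two algorithms are mutually inverse -/

theorem IsLe.ofNecklace_ohNecklace {L : Diagram} (hkn : k ≤ n) (hL : L.IsLe k n) :
    ofNecklace n (L.ohNecklace k n) = L := by
  have hP := (isLe_iff_isLeSet hkn hL.fits).1 hL
  have h1 : L.ohNecklace k n 1 = rowLabels k n L.shape := if_pos rfl
  ext1
  · simp only [ofNecklace, h1, shapeOf_rowLabels hkn hL.fits]
  · simp only [ofNecklace, hL.ohNecklace_eq hkn, hP.neck_eq_self (.inl le_rfl),
      hP.biUnion_pairedSquares]

theorem IsLe.isGrassmannNecklace_ohNecklace {L : Diagram} (hkn : k ≤ n) (hL : L.IsLe k n) :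
    IsGrassmannNecklace k n (L.ohNecklace k n) := by
  have hP := (isLe_iff_isLeSet hkn hL.fits).1 hL
  intro i hi
  simp only [hL.ohNecklace_eq hkn]
  refine ⟨hP.neck_subset i, (hP.card_neck i).trans (card_rowLabels hL.fits), ?_⟩
  have hstep := hP.necklaceStep i hi
  split_ifs with hin
  · subst hin
    rw [hP.neck_eq_self (k := 1) (.inl le_rfl)]
    rwa [hP.neck_eq_self (k := i + 1) (.inr (by omega))] at hstep
  · exact hstep

theorem IsGrassmannNecklace.isNecklaceFrom {I : ℕ → Finset ℕ} (hn : 1 ≤ n)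
    (hI : IsGrassmannNecklace k n I) :
    IsNecklaceFrom n (I 1) fun i => if i = n + 1 then I 1 else I i := by
  have h1 := hI 1 (Finset.mem_Icc.2 ⟨le_rfl, hn⟩)
  refine ⟨if_neg (by omega), if_pos rfl, fun i hi hin => ?_, fun i hi hin => ?_, fun i hi => ?_⟩
  · split_ifs with h
    · exact h1.1
    · exact (hI i (Finset.mem_Icc.2 (by omega))).1
  · split_ifs with h
    · rfl
    · rw [h1.2.1, (hI i (Finset.mem_Icc.2 (by omega))).2.1]
  · have hi' := Finset.mem_Icc.1 hi
    have h2 := (hI i hi).2.2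
    by_cases hin : i = n
    · subst hin
      simpa [NecklaceStep] using h2
    · simpa [NecklaceStep, hin, show i ≠ n + 1 by omega] using h2

theorem IsGrassmannNecklace.exists_isLe {I : ℕ → Finset ℕ} (hn : 1 ≤ n) (hkn : k ≤ n)
    (hI : IsGrassmannNecklace k n I) :
    ∃ L : Diagram, L.IsLe k n ∧ ∀ i ∈ Finset.Icc 1 n, L.ohNecklace k n i = I i := by
  obtain ⟨hsub, hcard, -⟩ := hI 1 (Finset.mem_Icc.2 ⟨le_rfl, hn⟩)
  obtain ⟨P, hP, hneck⟩ := exists_neck_eq (I 1) hsub _ (hI.isNecklaceFrom hn)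
  have hrow := rowLabels_shapeOf hsub hcard
  have hL : IsLe k n ⟨shapeOf n (I 1), P⟩ :=
    (isLe_iff_isLeSet hkn (fits_shapeOf hsub hcard)).2 (hrow.symm ▸ hP)
  refine ⟨_, hL, fun i hi => ?_⟩
  have hi' := Finset.mem_Icc.1 hi
  rw [hL.ohNecklace_eq hkn, hrow, hneck i hi'.1 (by omega), if_neg (by omega)]

theorem ofNecklace_congr {I J : ℕ → Finset ℕ} (hn : 1 ≤ n)
    (h : ∀ i ∈ Finset.Icc 1 n, I i = J i) : ofNecklace n I = ofNecklace n J := by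
  have h1 := h 1 (Finset.mem_Icc.2 ⟨le_rfl, hn⟩)
  ext1
  · simp only [ofNecklace, h1]
  · simp only [ofNecklace, h1]
    refine Finset.biUnion_congr rfl fun i hi => ?_
    rw [h i (Finset.Icc_subset_Icc_left (by omega) hi)]

end Diagram

theorem mainTheorem1 (k n : ℕ) (hn : 1 ≤ n) (hkn : k ≤ n) :
    (∀ L : Diagram, L.IsLe k n →
      Diagram.IsGrassmannNecklace k n (L.ohNecklace k n) ∧
        Diagram.ofNecklace n (L.ohNecklace k n) = L) ∧
    (∀ I : ℕ → Finset ℕ, Diagram.IsGrassmannNecklace k n I →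
      (Diagram.ofNecklace n I).IsLe k n ∧
        (∀ i ∈ Finset.Icc 1 n, (Diagram.ofNecklace n I).ohNecklace k n i = I i) ∧
        ∀ L : Diagram, L.IsLe k n → (∀ i ∈ Finset.Icc 1 n, L.ohNecklace k n i = I i) →
          L = Diagram.ofNecklace n I) := by
  have huniq : ∀ I : ℕ → Finset ℕ, ∀ L : Diagram, L.IsLe k n →
      (∀ i ∈ Finset.Icc 1 n, L.ohNecklace k n i = I i) → L = Diagram.ofNecklace n I :=
    fun I L hL h => (hL.ofNecklace_ohNecklace hkn).symm.trans (Diagram.ofNecklace_congr hn h)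
  refine ⟨fun L hL => ⟨hL.isGrassmannNecklace_ohNecklace hkn, hL.ofNecklace_ohNecklace hkn⟩,
    fun I hI => ?_⟩
  obtain ⟨L, hL, h⟩ := hI.exists_isLe hn hkn
  -- The diagram obtained from surjectivity must be the output of the reverse algorithm, so that
  -- output inherits all its properties.
  obtain rfl := huniq I L hL h
  exact ⟨hL, h, huniq I⟩
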